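/- A curve $C$ in the plane is a \emph{$k$-gon} if it is the boundary of a convex polygon with exactly $k$ corners ($k\ge 3$). A family $C_1,\dots,C_n$ of simple closed curves in the plane, any two of which meet in finitely many points, is an \emph{$n$-Venn diagram} if each of the $2^n$ sets $X_1\cap\cdots\cap X_n$, where each $X_i$ is either the interior or the exterior of $C_i$, is non-empty and connected. It is \emph{simple} if no point lies on more than two of the curves. Let $k^*(n)$ be the least $k$ for which there is an $n$-Venn diagram (simple or not) all of whose curves are $k$-gons. Let $Q_0$ be the quadrilateral with corners, in cyclic order, $$(-0.446,\,0),\quad (-0.123,\,-0.433),\quad (0.699,\,0.061),\quad (-0.081,\,0.451),$$ and for $0\le i\le 6$ let $Q_i$ be the image of $Q_0$ under the rotation by $2\pi i/7$ about the origin. Then $Q_0,\dots,Q_6$ are pairwise congruent convex $4$-gons, and they form a simple $7$-Venn diagram that is rotationally symmetric: the rotation by $2\pi/7$ about the origin maps each $Q_i$ onto $Q_{i+1}$ (indices modulo $7$). Moreover, the lower bound $k\ge\left\lceil \frac{2^n-2-n}{n(n-2)}\right\rceil$ for simple $n$-Venn diagrams of $k$-gons is tight for $n=7$: the least $k$ for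 which a simple $7$-Venn diagram of $k$-gons exists is $\left\lceil \frac{2^7-2-7}{7\cdot 5}\right\rceil = 4$. Finally, $k^*(7)=4$; in particular, no $7$-Venn diagram, simple or not, consists of triangles. -/

import Mathlib

namespace KGonVenn

/-! The Euclidean plane is `ℂ`, with its usual metric and real vector space structure. -/

/-- `C` is a simple closed curve: an injective continuous image of the circle. -/
def IsSimpleClosedCurve (C : Set ℂ) : Prop :=
  ∃ γ : Circle → ℂ, Continuous γ ∧ Function.Injective γ ∧ Set.range γ = C

/-- The interior of a closed curve: the points off the curve that lie in a bounded component of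
the complement. -/
def curveInterior (C : Set ℂ) : Set ℂ :=
  {z | z ∉ C ∧ Bornology.IsBounded (connectedComponentIn Cᶜ z)}

/-- The exterior of a closed curve: the points off the curve that lie in an unbounded component of
the complement. -/
def curveExterior (C : Set ℂ) : Set ℂ :=
  {z | z ∉ C ∧ ¬ Bornology.IsBounded (connectedComponentIn Cᶜ z)}

/-- The set of points interior to the curves indexed by `S` and exterior to all the others. -/
def region {n : ℕ} (C : Fin n → Set ℂ) (S : Set (Fin n)) : Set ℂ :=
  (⋂ i ∈ S, curveInterior (C i)) ∩ ⋂ i ∈ Sᶜ, curveExterior (C i)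

/-- A family of `n` finitely intersecting simple closed curves is an `n`-Venn diagram if all the
`2 ^ n` regions are nonempty and connected (`IsConnected` includes nonemptiness). -/
structure IsVennDiagram {n : ℕ} (C : Fin n → Set ℂ) : Prop where
  simpleClosedCurve : ∀ i, IsSimpleClosedCurve (C i)
  finite_inter : ∀ i j, i ≠ j → (C i ∩ C j).Finite
  region_connected : ∀ S : Set (Fin n), IsConnected (region C S)

/-- At most two curves pass through any point. -/
def IsSimpleFamily {n : ℕ} (C : Fin n → Set ℂ) : Prop :=
  ∀ z : ℂ, {i | z ∈ C i}.ncard ≤ 2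

/-- The counterclockwise rotation by the angle `θ` about the point `c`. -/
noncomputable def rotationAbout (c : ℂ) (θ : ℝ) (z : ℂ) : ℂ :=
  c + Complex.exp (θ * Complex.I) * (z - c)

/-- Each curve is mapped onto the (cyclically) next one by the rotation by `2π / n` about the
centre `c`. -/
def IsRotationallySymmetric {n : ℕ} (c : ℂ) (C : Fin n → Set ℂ) : Prop :=
  ∀ i, C (finRotate n i) = rotationAbout c (2 * Real.pi / n) '' C i

/-- Two plane sets are congruent if an isometry of the plane carries one to the other. -/
def IsCongruent (A B : Set ℂ) : Prop :=
  ∃ g : ℂ ≃ᵢ ℂ, g '' A = B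

/-- A polygon is convex with exactly `k` corners (and so exactly `k` sides): its `k ≥ 3` vertices
are in strictly convex position, and its sides, joining cyclically consecutive vertices, form the
boundary of the convex hull of the vertices. -/
structure IsConvexPolygon {k : ℕ} (p : Polygon ℂ k) : Prop where
  three_le : 3 ≤ k
  convexIndependent : ConvexIndependent ℝ p.vertices
  boundary_eq : p.boundary ℝ = frontier (convexHull ℝ (Set.range p.vertices))

/-- The curve `C` is a (convex) `k`-gon. -/
def IsKGon (k : ℕ) (C : Set ℂ) : Prop :=
  ∃ p : Polygon ℂ k, IsConvexPolygon p ∧ p.boundary ℝ = C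

/-- `k^*(n)`: the minimal `k` such that there is an `n`-Venn diagram, simple or not, of
convex `k`-gons. -/
noncomputable def kStar (n : ℕ) : ℕ :=
  sInf {k | ∃ C : Fin n → Set ℂ, IsVennDiagram C ∧ ∀ i, IsKGon k (C i)}

/-- The `k` for which there is a simple `n`-Venn diagram of convex `k`-gons. -/
def simpleSizes (n : ℕ) : Set ℕ :=
  {k | ∃ C : Fin n → Set ℂ, IsVennDiagram C ∧ IsSimpleFamily C ∧ ∀ i, IsKGon k (C i)}

/-- The lower bound `⌈(2 ^ n - 2 - n) / (n (n - 2))⌉`. -/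
def lowerBound (n : ℕ) : ℕ :=
  ⌈((2 : ℚ) ^ n - 2 - n) / (n * (n - 2))⌉₊

/-- The explicit quadrilateral, by its corners. -/
noncomputable def quad : Polygon ℂ 4 :=
  ⟨![⟨-0.446, 0⟩, ⟨-0.123, -0.433⟩, ⟨0.699, 0.061⟩, ⟨-0.081, 0.451⟩]⟩

/-- The `i`-th rotated copy of the quadrilateral, as a curve, for `i = 0, …, 6`. -/
noncomputable def sevenQuads (i : Fin 7) : Set ℂ :=
  rotationAbout 0 (2 * Real.pi * (i : ℕ) / 7) '' quad.boundary ℝ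

end KGonVenn

/-! The existence half is a certified computation. The origin lies inside all seven quadrilaterals,
so each is the set where its gauge `quadGauge i`, a maximum of four linear forms, equals 1, with
interior and exterior given by gauge below and above 1. For a nonempty proper S, the region of S is
a radial product of an open interval with `innerCone S`, the set of points where every gauge of S is
smaller than every other gauge. So only the order of the seven gauges in each direction matters.

The plane is cut into 133 sectors. In each, at most one pair of gauges changes order, both are
linear there, and they are neighbours in the order behind the sector. Such a change creates exactly
one new initial segment of the order. The 126 changes in a full turn create the 126 nonempty proper
sets once each, so the rays on which S is an initial segment form a single cyclic run, and
`innerCone S` is connected (`isConnected_innerCone`). The same sectors give finiteness of the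
intersections and simplicity. Checks on integers with an error margin suffice
(`certifiedSector_zip`), because a linear inequality on two rays holds on the cone between them.

For the lower bound, suppose that seven triangles form a Venn diagram. Fix a direction in which no
side is horizontal and assign to each nonempty S the lowest point of its region. If m triangles pass
through p and b of them have p as lowest corner, at most m + b side directions rise from p, so at
most m + b - 1 regions have lowest point p, and m - 1 is at most the number of pairs of triangles
through p. Summation gives `two_mul_card_regions_le`: over ordered pairs, the intersection numbers
add up to at least 2 * 127 - 14 = 240.

Two triangles meet in at most six points, which only yields 252. But each triangle loses at least
two (`sum_ncard_inter_le`). If two of its corners lie in no other triangle, the connected region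
inside it alone touches both, so no other triangle can cut between them, and each meets it in at
most four points. Otherwise at least two corners lie in other triangles, and each costs an
intersection point. Hence the sum is at most 7 * 34 = 238, a contradiction. -/

namespace KGonVenn

/-! ### The integer certificate for the order of the seven curves around the origin. -/

/-- Integer approximations, scaled by `10 ^ 6`, of the normals of the sides of the rotated copies of
the quadrilateral; the normal of the side `e` of the copy `i` has the index `4 * i + e`. -/
def approxNormals : List (ℤ × ℤ) :=
  [(-2242152, -1672553), (1673646, -2784892), (1218027, 2436054), (-2242152, 1814602),
    (-90305, -2795805), (3220818, -427843), (-1145156, 2471146), (-2816672, -621599),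
    (2129544, -1813759), (2342648, 2251381), (-2646013, 645415), (-1270181, -2589724),
    (2745803, 534084), (-299583, 3235269), (-2154368, -1666326), (1232783, -2607734),
    (1294416, 2479751), (-2716222, 1782934), (-40440, -2723290), (2807436, -662067),
    (-1131692, 2558115), (-3087491, -1011987), (2103940, -1729561), (2268032, 1782150),
    (-2705613, 710166), (-1133815, -3044861), (2664011, 566563), (20754, 2884371)]

/-- The approximation of the normal of the side `e` of the copy `i`. -/
def approxNormal (i : Fin 7) (e : Fin 4) : ℤ × ℤ :=
  approxNormals.getD (4 * i.val + e.val) (0, 0)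

/-- A direction `(x, y)`, together with the order (in base `8`) in which the seven curves are met
by the ray in that direction, and the pair `fst`, `snd` of curves that change places before the
next direction (`0`, `0` if there is none). -/
structure Direction where
  x : ℤ
  y : ℤ
  order : ℕ
  fst : Fin 7
  snd : Fin 7

/-- The position of the curve `i` on the ray. -/
def Direction.rank (d : Direction) (i : Fin 7) : ℕ := d.order / 8 ^ i.val % 8

/-- The scaled approximate value of the linear form of the side `e` of the copy `i`. -/
def Direction.value (d : Direction) (i : Fin 7) (e : Fin 4) : ℤ :=
  (approxNormal i e).1 * d.x + (approxNormal i e).2 * d.y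

/-- A bound for the error of a difference of two approximate values. -/
def valueMargin : ℤ := 200000

/-- Some side of `j` lies below all the sides of `i` in the sector between `d` and `d'`. -/
def CertifiedBelow (d d' : Direction) (i j : Fin 7) : Prop :=
  ∃ e, ∀ f, valueMargin < d.value j e - d.value i f ∧ valueMargin < d'.value j e - d'.value i f

/-- Only the side `e` of `i` is met in the sector between `d` and `d'`. -/
def CertifiedLinear (d d' : Direction) (i : Fin 7) (e : Fin 4) : Prop :=
  ∀ f, f = e ∨ valueMargin < d.value i e - d.value i f ∧ valueMargin < d'.value i e - d'.value i f

/-- In the sector between `d` and `d'`, a side of `i` crosses a side of `j`. -/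
def CertifiedCrossing (d d' : Direction) (i j : Fin 7) : Prop :=
  ∃ e f, (valueMargin < d.value j f - d.value i e ∧ valueMargin < d'.value i e - d'.value j f) ∧
    CertifiedLinear d d' i e ∧ CertifiedLinear d d' j f

/-- The sector between `d` and `d'` is as described by `d`. -/
def CertifiedSector (d d' : Direction) : Prop :=
  (0 < d.x * d'.y - d.y * d'.x ∧ |d.x| + |d.y| ≤ 50000) ∧
  (∀ i j, i ≠ j → d.rank i ≠ d.rank j) ∧
  ∀ i j, d.rank i < d.rank j →
    (d'.rank i < d'.rank j ∧ CertifiedBelow d d' i j) ∨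
    (i = d.fst ∧ j = d.snd ∧ d'.rank j + 1 = d'.rank i ∧ CertifiedCrossing d d' i j)

instance (d d' : Direction) : Decidable (CertifiedSector d d') := by
  unfold CertifiedSector CertifiedBelow CertifiedCrossing CertifiedLinear
  infer_instance

/-- The directions bounding the sectors, in cyclic order; the last is the first one again. -/
def directions : List Direction :=
  [⟨30000, 0, 841904, 3, 4⟩, ⟨29799, 3466, 838320, 6, 4⟩, ⟨29626, 4720, 1096368, 2, 4⟩,
    ⟨29470, 5615, 1092336, 2, 6⟩, ⟨29296, 6459, 830256, 5, 4⟩, ⟨29208, 6846, 858928, 2, 3⟩,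
    ⟨28528, 9283, 858480, 5, 6⟩, ⟨28509, 9341, 629104, 2, 1⟩, ⟨28020, 10718, 629160, 5, 3⟩,
    ⟨27551, 11871, 661416, 5, 1⟩, ⟨26905, 13271, 694176, 3, 1⟩, ⟨26181, 14647, 694680, 6, 1⟩,
    ⟨25011, 16566, 956816, 4, 1⟩, ⟨24587, 17190, 960904, 0, 1⟩, ⟨24397, 17459, 960897, 4, 6⟩,
    ⟨24051, 17932, 702849, 4, 3⟩, ⟨23734, 18350, 706433, 0, 6⟩, ⟨23392, 18784, 444290, 0, 3⟩,
    ⟨19910, 22441, 443779, 0, 0⟩, ⟨18705, 23455, 443779, 4, 5⟩, ⟨15870, 25459, 415107, 0, 5⟩,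
    ⟨14782, 26106, 382340, 3, 5⟩, ⟨13984, 26541, 350084, 3, 0⟩, ⟨13216, 26932, 350595, 6, 5⟩,
    ⟨12859, 27105, 579971, 3, 4⟩, ⟨10529, 28092, 576387, 6, 0⟩, ⟨10472, 28113, 838530, 3, 2⟩,
    ⟨9091, 28589, 838978, 6, 4⟩, ⟨7897, 28942, 1097026, 6, 2⟩, ⟨6400, 29309, 1359106, 4, 2⟩,
    ⟨4872, 29602, 1363138, 0, 2⟩, ⟨2642, 29883, 1363075, 5, 2⟩, ⟨1890, 29940, 1395779, 1, 2⟩,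
    ⟨1561, 29959, 1395723, 5, 0⟩, ⟨976, 29984, 1428490, 5, 4⟩, ⟨451, 29997, 1457162, 1, 0⟩,
    ⟨-101, 30000, 1457169, 1, 4⟩, ⟨-5131, 29558, 1453081, 0, 0⟩, ⟨-6676, 29248, 1453081, 5, 6⟩,
    ⟨-10010, 28281, 1223705, 1, 6⟩, ⟨-11194, 27833, 961569, 4, 6⟩, ⟨-12032, 27482, 703521, 4, 1⟩,
    ⟨-12816, 27125, 707609, 0, 6⟩, ⟨-13174, 26953, 445466, 4, 5⟩, ⟨-15399, 25747, 416794, 0, 1⟩,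
    ⟨-15451, 25715, 416787, 4, 3⟩, ⟨-16684, 24933, 420371, 0, 5⟩, ⟨-17704, 24219, 387604, 0, 3⟩,
    ⟨-18925, 23278, 387093, 5, 3⟩, ⟨-20106, 22266, 419349, 1, 3⟩, ⟨-21716, 20698, 418845, 6, 3⟩,
    ⟨-22230, 20146, 680477, 2, 3⟩, ⟨-22450, 19900, 680029, 6, 1⟩, ⟨-22834, 19458, 942165, 6, 5⟩,
    ⟨-23171, 19055, 1171541, 2, 1⟩, ⟨-23518, 18626, 1171597, 2, 5⟩, ⟨-26309, 14417, 1138893, 0, 0⟩,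
    ⟨-27029, 13017, 1138893, 6, 0⟩, ⟨-28352, 9807, 1401036, 2, 0⟩, ⟨-28740, 8602, 1401099, 5, 0⟩,
    ⟨-28988, 7728, 1433866, 5, 2⟩, ⟨-29198, 6892, 1466570, 1, 0⟩, ⟨-29286, 6505, 1466577, 5, 6⟩,
    ⟨-29730, 4014, 1237201, 1, 2⟩, ⟨-29738, 3954, 1237145, 5, 4⟩, ⟨-29896, 2501, 1265817, 1, 6⟩,
    ⟨-29974, 1259, 1003681, 1, 4⟩, ⟨-29999, -283, 999593, 6, 4⟩, ⟨-29944, -1837, 1257641, 2, 4⟩,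
    ⟨-29722, -4074, 1253609, 0, 4⟩, ⟨-29610, -4819, 1249514, 3, 4⟩, ⟨-29556, -5145, 1245930, 0, 2⟩,
    ⟨-29450, -5721, 1245867, 0, 6⟩, ⟨-29345, -6235, 983724, 3, 2⟩, ⟨-29225, -6774, 984172, 3, 6⟩,
    ⟨-27675, -11580, 722540, 0, 0⟩, ⟨-27029, -13017, 722540, 0, 1⟩, ⟨-25344, -16052, 722533, 3, 1⟩,
    ⟨-24645, -17107, 723037, 6, 1⟩, ⟨-24115, -17845, 985173, 6, 3⟩, ⟨-23593, -18530, 1246805, 2, 1⟩,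
    ⟨-23345, -18841, 1246861, 6, 0⟩, ⟨-21675, -20742, 1509004, 2, 3⟩,
    ⟨-21633, -20785, 1508556, 6, 5⟩,
    ⟨-20595, -21814, 1737932, 2, 0⟩, ⟨-19672, -22650, 1737995, 2, 5⟩,
    ⟨-18483, -23630, 1705291, 0, 5⟩,
    ⟨-17234, -24556, 1672524, 3, 5⟩, ⟨-15347, -25778, 1640268, 1, 5⟩,
    ⟨-14694, -26155, 1607508, 4, 5⟩,
    ⟨-14405, -26315, 1578836, 1, 3⟩, ⟨-13889, -26591, 1578332, 1, 0⟩,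
    ⟨-13421, -26830, 1578339, 4, 3⟩,
    ⟨-12925, -27073, 1581923, 4, 0⟩, ⟨-8202, -28857, 1586018, 0, 0⟩, ⟨-6676, -29248, 1586018, 1, 2⟩,
    ⟨-3252, -29823, 1585962, 4, 2⟩, ⟨-1991, -29934, 1589994, 0, 2⟩, ⟨-1084, -29980, 1589931, 0, 4⟩,
    ⟨-222, -29999, 1585836, 3, 2⟩, ⟨175, -29999, 1586284, 0, 1⟩, ⟨2703, -29878, 1586277, 3, 4⟩,
    ⟨2763, -29872, 1582693, 0, 6⟩, ⟨4214, -29703, 1320550, 3, 1⟩, ⟨5443, -29502, 1321054, 3, 6⟩,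
    ⟨6951, -29184, 1059422, 1, 6⟩, ⟨8454, -28784, 797286, 4, 6⟩, ⟨10585, -28070, 539238, 2, 6⟩,
    ⟨11287, -27796, 277158, 5, 6⟩, ⟨11592, -27670, 47782, 2, 4⟩, ⟨12130, -27438, 43750, 2, 1⟩,
    ⟨12609, -27222, 43806, 5, 4⟩, ⟨13107, -26985, 72478, 5, 1⟩, ⟨17448, -24404, 105238, 0, 0⟩,
    ⟨18705, -23455, 105238, 2, 3⟩, ⟨21289, -21137, 104790, 5, 3⟩, ⟨22162, -20220, 137046, 1, 3⟩,
    ⟨22764, -19540, 136542, 1, 5⟩, ⟨23316, -18878, 103782, 4, 3⟩, ⟨23564, -18568, 107366, 1, 2⟩,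
    ⟨25045, -16516, 107310, 4, 5⟩, ⟨25078, -16465, 78638, 1, 0⟩, ⟨25850, -15225, 78645, 4, 2⟩,
    ⟨26459, -14139, 82677, 4, 0⟩, ⟨27151, -12761, 86772, 2, 0⟩, ⟨27775, -11337, 86835, 5, 0⟩,
    ⟨28546, -9226, 119602, 3, 0⟩, ⟨28769, -8505, 120113, 6, 0⟩, ⟨28861, -8189, 382256, 3, 5⟩,
    ⟨29015, -7624, 350000, 3, 2⟩, ⟨29144, -7115, 350448, 6, 5⟩, ⟨29270, -6577, 579824, 6, 2⟩,
    ⟨29959, -1575, 841904, 0, 0⟩, ⟨30000, 0, 841904, 3, 4⟩]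

/-- The number of sectors. -/
abbrev sectorCount : ℕ := 133

/-- The `k`-th direction. -/
def direction (k : ℕ) : Direction := directions.getD k ⟨0, 0, 0, 0, 0⟩

/-- The set of the innermost curves, as a bit mask, that first occurs behind the sector before
`d'`, where `a` is the curve that has moved in. -/
def newMask (d' : Direction) (a : Fin 7) : ℕ :=
  Nat.ofBits fun i : Fin 7 => decide (d'.rank i ≤ d'.rank a)

/-- The sector behind which a given set of curves, as a bit mask, first consists of the innermost
curves. -/
def firstSectors : List ℕ :=
  [0, 127, 13, 12, 32, 35, 31, 33, 51, 61, 54, 59, 50, 63, 52, 60, 70, 4, 80, 11,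
    73, 36, 78, 34, 69, 68, 82, 84, 71, 67, 79, 81, 89, 130, 23, 25, 99, 131, 30, 29,
    92, 93, 55, 58, 97, 96, 53, 57, 88, 2, 87, 27, 101, 1, 103, 28, 90, 91, 86, 85,
    98, 95, 100, 83, 108, 126, 16, 14, 42, 40, 44, 41, 118, 125, 17, 15, 49, 65, 48, 62,
    111, 6, 112, 10, 74, 39, 77, 38, 116, 8, 115, 9, 72, 66, 76, 64, 107, 128, 21, 22,
    106, 129, 46, 43, 120, 124, 20, 19, 122, 123, 47, 45, 109, 3, 110, 24, 105, 0, 104, 26,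
    117, 5, 114, 7, 119, 121, 102, 0]

/-- The list ends with its first entry, so these pairs cover the full turn. All geometry of the
arrangement is reduced to this integer check. -/
theorem certifiedSector_zip :
    ∀ p ∈ directions.zip directions.tail, CertifiedSector p.1 p.2 := by
  decide +kernel

/-- The table inverts the passage from crossing sectors to masks, so no set becomes an initial
segment twice. -/
theorem firstSectors_newMask :
    ∀ k : Fin sectorCount, (direction k).fst ≠ (direction k).snd →
      firstSectors.getD (newMask (direction (k + 1)) (direction k).snd) 0 = k := by
  decide +kernel

/-- The converse inversion: every nonempty proper set does become an initial segment. The table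
entries at 0 and 127 are placeholders. -/
theorem newMask_firstSectors :
    ∀ m : Fin 128, m ≠ 0 → m ≠ 127 →
      firstSectors.getD m 0 < sectorCount ∧
      (direction (firstSectors.getD m 0)).fst ≠ (direction (firstSectors.getD m 0)).snd ∧
      newMask (direction (firstSectors.getD m 0 + 1)) (direction (firstSectors.getD m 0)).snd
        = m := by
  decide +kernel

/-! ### Interior and exterior of the boundary of a compact convex set. -/

section ConvexCurves

lemma compl_frontier_eq {K : Set ℂ} (hK : IsClosed K) : (frontier K)ᶜ = interior K ∪ Kᶜ := by
  rw [hK.frontier_eq]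
  ext z
  have := @interior_subset _ _ K z
  simp only [Set.mem_compl_iff, Set.mem_sdiff, Set.mem_union]
  tauto

lemma isBounded_component_of_mem_interior {K : Set ℂ} (hK : IsCompact K) {z : ℂ}
    (hz : z ∈ interior K) : Bornology.IsBounded (connectedComponentIn (frontier K)ᶜ z) := by
  refine (hK.isBounded.subset interior_subset).subset ?_
  have hsub := connectedComponentIn_subset (frontier K)ᶜ z
  rw [compl_frontier_eq hK.isClosed] at hsub ⊢
  refine isPreconnected_connectedComponentIn.subset_left_of_subset_union isOpen_interior
    hK.isClosed.isOpen_compl ?_ hsub ⟨z, mem_connectedComponentIn (Or.inl hz), hz⟩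
  exact disjoint_compl_right.mono_left interior_subset

lemma not_isBounded_component_of_notMem {K : Set ℂ} (hc : Convex ℝ K) (hK : IsCompact K) {z : ℂ}
    (hz : z ∉ K) : ¬ Bornology.IsBounded (connectedComponentIn (frontier K)ᶜ z) := by
  obtain ⟨f, u, hf, hu⟩ := geometric_hahn_banach_closed_point hc hK.isClosed hz
  -- A direction in which the separating functional does not decrease: the ray from `z` along it
  -- never enters `K`.
  obtain ⟨v, hv, hfv⟩ : ∃ v : ℂ, v ≠ 0 ∧ 0 ≤ f v := by
    rcases le_total 0 (f 1) with h | h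
    · exact ⟨1, one_ne_zero, h⟩
    · exact ⟨-1, by simp, by simpa using h⟩
  set ray : Set ℂ := (fun t : ℝ => z + t • v) '' Set.Ici 0 with hray
  have hconn : IsPreconnected ray :=
    isPreconnected_Ici.image _ (by fun_prop)
  have hsub : ray ⊆ (frontier K)ᶜ := by
    rintro _ ⟨t, ht, rfl⟩ hmem
    have h1 := hf _ (hK.isClosed.frontier_subset hmem)
    simp only [map_add, map_smul, smul_eq_mul] at h1
    have := mul_nonneg (Set.mem_Ici.1 ht) hfv
    linarith
  intro hb
  have hb' := hb.subset (hconn.subset_connectedComponentIn ⟨0, by simp, by simp⟩ hsub)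
  obtain ⟨R, hR⟩ := hb'.exists_norm_le
  have hvn : 0 < ‖v‖ := norm_pos_iff.2 hv
  have hR0 : 0 ≤ R := (norm_nonneg z).trans (hR z ⟨0, by simp, by simp⟩)
  have h := hR _ ⟨(R + ‖z‖ + 1) / ‖v‖, by simp only [Set.mem_Ici]; positivity, rfl⟩
  have h2 : ‖((R + ‖z‖ + 1) / ‖v‖) • v‖ = R + ‖z‖ + 1 := by
    rw [norm_smul, Real.norm_of_nonneg (by positivity), div_mul_cancel₀ _ hvn.ne']
  have h3 := norm_sub_le (z + ((R + ‖z‖ + 1) / ‖v‖) • v) z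
  rw [add_sub_cancel_left, h2] at h3
  linarith

/-- The interior of the boundary curve of a compact convex set is the topological interior. -/
lemma curveInterior_frontier {K : Set ℂ} (hc : Convex ℝ K) (hK : IsCompact K) :
    curveInterior (frontier K) = interior K := by
  ext z
  constructor
  · rintro ⟨hz, hb⟩
    have hz' : z ∈ (frontier K)ᶜ := hz
    rw [compl_frontier_eq hK.isClosed] at hz'
    exact hz'.resolve_right fun h => not_isBounded_component_of_notMem hc hK h hb
  · intro hz
    refine ⟨fun h => ?_, isBounded_component_of_mem_interior hK hz⟩
    exact h.2 hz

/-- The exterior of the boundary curve of a compact convex set is the complement. -/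
lemma curveExterior_frontier {K : Set ℂ} (hc : Convex ℝ K) (hK : IsCompact K) :
    curveExterior (frontier K) = Kᶜ := by
  ext z
  constructor
  · rintro ⟨hz, hb⟩
    have hz' : z ∈ (frontier K)ᶜ := hz
    rw [compl_frontier_eq hK.isClosed] at hz'
    exact hz'.resolve_left fun h => hb (isBounded_component_of_mem_interior hK h)
  · intro hz
    exact ⟨fun h => hz (hK.isClosed.frontier_subset h), not_isBounded_component_of_notMem hc hK hz⟩

end ConvexCurves

/-! ### Numerical bounds for the sines and cosines of multiples of 2π/7. -/

section Heptagon

/-- For θ = 2π/7 the angles 3θ and 4θ add up to a full turn, so their cosines agree. This is a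
quartic equation for the cosine, from which the root 1 is divided out. -/
lemma cos_two_pi_div_seven_cubic (c : ℝ) (hc : c = Real.cos (2 * Real.pi / 7)) :
    8 * c ^ 3 + 4 * c ^ 2 - 4 * c - 1 = 0 := by
  have h3 : Real.cos (3 * (2 * Real.pi / 7)) = Real.cos (4 * (2 * Real.pi / 7)) := by
    rw [← Real.cos_two_pi_sub]
    congr 1
    ring
  rw [Real.cos_three_mul, show 4 * (2 * Real.pi / 7) = 2 * (2 * (2 * Real.pi / 7)) by ring,
    Real.cos_two_mul, Real.cos_two_mul, ← hc] at h3
  have hne : c - 1 ≠ 0 := by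
    have := Real.cos_lt_cos_of_nonneg_of_le_pi le_rfl (y := 2 * Real.pi / 7)
      (by linarith [Real.pi_pos]) (by linarith [Real.pi_pos])
    rw [Real.cos_zero, ← hc] at this
    linarith
  have : (c - 1) * (8 * c ^ 3 + 4 * c ^ 2 - 4 * c - 1) = 0 := by linear_combination -h3
  exact (mul_eq_zero.1 this).resolve_left hne

lemma cos_two_pi_div_seven_bounds :
    0.623489801 < Real.cos (2 * Real.pi / 7) ∧ Real.cos (2 * Real.pi / 7) < 0.623489802 := by
  have h := cos_two_pi_div_seven_cubic _ rfl
  have h0 : 0 < Real.cos (2 * Real.pi / 7) :=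
    Real.cos_pos_of_mem_Ioo ⟨by linarith [Real.pi_pos], by linarith [Real.pi_pos]⟩
  generalize Real.cos (2 * Real.pi / 7) = c at h h0
  constructor
  · by_contra! hle
    nlinarith [mul_nonneg h0.le (sub_nonneg.2 hle),
      mul_nonneg (mul_nonneg h0.le h0.le) (sub_nonneg.2 hle)]
  · by_contra! hle
    nlinarith [mul_nonneg h0.le (sub_nonneg.2 hle),
      mul_nonneg (mul_nonneg h0.le h0.le) (sub_nonneg.2 hle)]

lemma sin_two_pi_div_seven_bounds :
    0.781831481 < Real.sin (2 * Real.pi / 7) ∧ Real.sin (2 * Real.pi / 7) < 0.781831484 := by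
  obtain ⟨h1, h2⟩ := cos_two_pi_div_seven_bounds
  have h := Real.sin_sq_add_cos_sq (2 * Real.pi / 7)
  have h0 : 0 < Real.sin (2 * Real.pi / 7) :=
    Real.sin_pos_of_pos_of_lt_pi (by linarith [Real.pi_pos]) (by linarith [Real.pi_pos])
  constructor <;> nlinarith

/-- Rational approximations of the cosines of the multiples of `2π / 7`. -/
def cosApprox : Fin 7 → ℚ :=
  ![1, 0.6234898, -0.2225209, -0.9009689, -0.9009689, -0.2225209, 0.6234898]

/-- Rational approximations of the sines of the multiples of `2π / 7`. -/
def sinApprox : Fin 7 → ℚ :=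
  ![0, 0.7818315, 0.9749279, 0.4338837, -0.4338837, -0.9749279, -0.7818315]

/-- The angle of the rotation that carries the first quadrilateral to the `i`-th. -/
noncomputable def turn (i : Fin 7) : ℝ := 2 * Real.pi * (i : ℕ) / 7

lemma cosApprox_sinApprox (i : Fin 7) :
    |Real.cos (turn i) - cosApprox i| ≤ 1 / 10 ^ 7 ∧
    |Real.sin (turn i) - sinApprox i| ≤ 1 / 10 ^ 7 := by
  obtain ⟨c1, c2⟩ := cos_two_pi_div_seven_bounds
  obtain ⟨s1, s2⟩ := sin_two_pi_div_seven_bounds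
  have hc2 := Real.cos_two_mul (2 * Real.pi / 7)
  have hs2 := Real.sin_two_mul (2 * Real.pi / 7)
  have hc3 := Real.cos_three_mul (2 * Real.pi / 7)
  have hs3 := Real.sin_three_mul (2 * Real.pi / 7)
  have e (k l : ℕ) (h : k + l = 7) : 2 * Real.pi * k / 7 = 2 * Real.pi - l * (2 * Real.pi / 7) := by
    have : (k : ℝ) = 7 - l := by rw [eq_sub_iff_add_eq]; exact_mod_cast h
    rw [this]; ring
  have e' (k : ℕ) : 2 * Real.pi * k / 7 = k * (2 * Real.pi / 7) := by ring
  -- Enclosures of the monomials in the multiple-angle formulas, after which all remaining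
  -- inequalities are linear.
  have b2 : 0.38873953 < Real.cos (2 * Real.pi / 7) ^ 2 ∧
      Real.cos (2 * Real.pi / 7) ^ 2 < 0.388739535 := by constructor <;> nlinarith
  have b3 : 0.24237513 < Real.cos (2 * Real.pi / 7) ^ 3 ∧
      Real.cos (2 * Real.pi / 7) ^ 3 < 0.242375140 := by constructor <;> nlinarith
  have b4 : 0.61126046 < Real.sin (2 * Real.pi / 7) ^ 2 ∧
      Real.sin (2 * Real.pi / 7) ^ 2 < 0.61126047 := by constructor <;> nlinarith
  have b5 : 0.477902671 < Real.sin (2 * Real.pi / 7) ^ 3 ∧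
      Real.sin (2 * Real.pi / 7) ^ 3 < 0.477902687 := by constructor <;> nlinarith
  have b6 : 0.48746395 < Real.sin (2 * Real.pi / 7) * Real.cos (2 * Real.pi / 7) ∧
      Real.sin (2 * Real.pi / 7) * Real.cos (2 * Real.pi / 7) < 0.48746396 := by
    constructor <;> nlinarith
  simp only [abs_le]
  unfold turn
  fin_cases i
  · simp [cosApprox, sinApprox]
  · simp only [Fin.mk_one, Nat.cast_one, mul_one]
    norm_num [cosApprox, sinApprox]
    refine ⟨⟨?_, ?_⟩, ?_, ?_⟩ <;> linarith
  · rw [e' 2]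
    norm_num [cosApprox, sinApprox]
    refine ⟨⟨?_, ?_⟩, ?_, ?_⟩ <;> linarith
  · rw [e' 3]
    norm_num [cosApprox, sinApprox]
    refine ⟨⟨?_, ?_⟩, ?_, ?_⟩ <;> linarith
  · rw [e 4 3 rfl, Real.cos_two_pi_sub, Real.sin_two_pi_sub]
    norm_num [cosApprox, sinApprox]
    refine ⟨⟨?_, ?_⟩, ?_, ?_⟩ <;> linarith
  · rw [e 5 2 rfl, Real.cos_two_pi_sub, Real.sin_two_pi_sub]
    norm_num [cosApprox, sinApprox]
    refine ⟨⟨?_, ?_⟩, ?_, ?_⟩ <;> linarith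
  · rw [e 6 1 rfl, Real.cos_two_pi_sub, Real.sin_two_pi_sub]
    norm_num [cosApprox, sinApprox]
    refine ⟨⟨?_, ?_⟩, ?_, ?_⟩ <;> linarith

end Heptagon

/-! ### The gauges of the quadrilaterals. -/

section Gauge

/-- The outer normals of the sides of the quadrilateral, normalised so that the sides lie at
height `1`. -/
noncomputable def sideNormal : Fin 4 → ℝ × ℝ :=
  ![(-433000 / 193118, -323000 / 193118), (494000 / 295164, -822000 / 295164),
    (390000 / 320190, 780000 / 320190), (-451000 / 201146, 365000 / 201146)]

/-- The linear form with value `1` on the side `e` of the `i`-th quadrilateral. -/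
noncomputable def sideForm (i : Fin 7) (e : Fin 4) : ℂ →L[ℝ] ℝ :=
  ((sideNormal e).1 * Real.cos (turn i) - (sideNormal e).2 * Real.sin (turn i)) • Complex.reCLM +
  ((sideNormal e).1 * Real.sin (turn i) + (sideNormal e).2 * Real.cos (turn i)) • Complex.imCLM

lemma sideForm_apply (i : Fin 7) (e : Fin 4) (z : ℂ) : sideForm i e z =
    ((sideNormal e).1 * Real.cos (turn i) - (sideNormal e).2 * Real.sin (turn i)) * z.re +
    ((sideNormal e).1 * Real.sin (turn i) + (sideNormal e).2 * Real.cos (turn i)) * z.im := rfl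

lemma turn_zero : turn 0 = 0 := by simp [turn]

lemma sideForm_zero_apply (e : Fin 4) (z : ℂ) : sideForm 0 e z =
    (sideNormal e).1 * z.re + (sideNormal e).2 * z.im := by
  simp [sideForm_apply, turn_zero]

lemma sideForm_rotation (i : Fin 7) (e : Fin 4) (z : ℂ) :
    sideForm i e (Complex.exp (turn i * Complex.I) * z) = sideForm 0 e z := by
  have h := Real.sin_sq_add_cos_sq (turn i)
  simp only [sideForm_apply, turn_zero, Complex.mul_re, Complex.mul_im,
    Complex.exp_ofReal_mul_I_re, Complex.exp_ofReal_mul_I_im, Real.cos_zero, Real.sin_zero]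
  linear_combination ((sideNormal e).1 * z.re + (sideNormal e).2 * z.im) * h

/-- The gauge (Minkowski functional) of the `i`-th quadrilateral. -/
noncomputable def quadGauge (i : Fin 7) (z : ℂ) : ℝ :=
  Finset.univ.sup' Finset.univ_nonempty fun e : Fin 4 => sideForm i e z

lemma quadGauge_lt_iff {i : Fin 7} {z : ℂ} {r : ℝ} :
    quadGauge i z < r ↔ ∀ e, sideForm i e z < r := by
  rw [quadGauge, Finset.sup'_lt_iff]
  simp

lemma quadGauge_le_iff {i : Fin 7} {z : ℂ} {r : ℝ} :
    quadGauge i z ≤ r ↔ ∀ e, sideForm i e z ≤ r := by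
  rw [quadGauge, Finset.sup'_le_iff]
  simp

lemma sideForm_le_quadGauge (i : Fin 7) (e : Fin 4) (z : ℂ) : sideForm i e z ≤ quadGauge i z :=
  quadGauge_le_iff.1 le_rfl e

lemma exists_sideForm_eq (i : Fin 7) (z : ℂ) : ∃ e, quadGauge i z = sideForm i e z := by
  obtain ⟨e, -, he⟩ := Finset.exists_mem_eq_sup' Finset.univ_nonempty
    fun e : Fin 4 => sideForm i e z
  exact ⟨e, he⟩

lemma quadGauge_smul (i : Fin 7) {t : ℝ} (ht : 0 ≤ t) (z : ℂ) :
    quadGauge i (t • z) = t * quadGauge i z := by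
  apply le_antisymm
  · rw [quadGauge_le_iff]
    intro e
    rw [map_smul, smul_eq_mul]
    exact mul_le_mul_of_nonneg_left (sideForm_le_quadGauge i e z) ht
  · obtain ⟨e, he⟩ := exists_sideForm_eq i z
    rw [he, ← smul_eq_mul, ← map_smul]
    exact sideForm_le_quadGauge i e _

lemma quadGauge_rotation (i : Fin 7) (z : ℂ) :
    quadGauge i (Complex.exp (turn i * Complex.I) * z) = quadGauge 0 z := by
  simp only [quadGauge, sideForm_rotation]

lemma continuous_quadGauge (i : Fin 7) : Continuous (quadGauge i) := by
  unfold quadGauge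
  exact Continuous.finset_sup'_apply _ fun e _ => (sideForm i e).continuous

lemma quadGauge_zero (i : Fin 7) : quadGauge i 0 = 0 := by
  simpa using quadGauge_smul i le_rfl 0

/-- The four outer normals positively span the plane, so the forms cannot all be nonpositive away
from the origin. -/
lemma quadGauge_zero_pos {z : ℂ} (hz : z ≠ 0) : 0 < quadGauge 0 z := by
  by_contra! h
  rw [quadGauge_le_iff] at h
  have h0 := h 0
  have h1 := h 1
  have h2 := h 2
  have h3 := h 3
  simp [sideForm_zero_apply, sideNormal] at h0 h1 h2 h3
  apply hz
  apply Complex.ext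
  · simp only [Complex.zero_re]; linarith
  · simp only [Complex.zero_im]; linarith

lemma exists_rotation_eq (i : Fin 7) (z : ℂ) :
    ∃ y, z = Complex.exp (turn i * Complex.I) * y ∧ ‖y‖ = ‖z‖ := by
  refine ⟨Complex.exp (-(turn i * Complex.I)) * z, ?_, ?_⟩
  · rw [← mul_assoc, ← Complex.exp_add]
    simp
  · rw [norm_mul, ← neg_mul, ← Complex.ofReal_neg, Complex.norm_exp_ofReal_mul_I, one_mul]

lemma quadGauge_pos (i : Fin 7) {z : ℂ} (hz : z ≠ 0) : 0 < quadGauge i z := by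
  obtain ⟨y, rfl, -⟩ := exists_rotation_eq i z
  rw [quadGauge_rotation]
  exact quadGauge_zero_pos (right_ne_zero_of_mul hz)

lemma norm_le_quadGauge (i : Fin 7) (z : ℂ) : ‖z‖ ≤ 2 * quadGauge i z := by
  obtain ⟨y, rfl, hy⟩ := exists_rotation_eq i z
  rw [quadGauge_rotation, ← hy]
  have h0 := sideForm_le_quadGauge 0 0 y
  have h1 := sideForm_le_quadGauge 0 1 y
  have h2 := sideForm_le_quadGauge 0 2 y
  have h3 := sideForm_le_quadGauge 0 3 y
  simp [sideForm_zero_apply, sideNormal] at h0 h1 h2 h3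
  refine (Complex.norm_le_abs_re_add_abs_im y).trans ?_
  rcases abs_cases y.re with ⟨a, -⟩ | ⟨a, -⟩ <;> rcases abs_cases y.im with ⟨b, -⟩ | ⟨b, -⟩ <;>
    rw [a, b] <;> linarith

/-- The quadrilateral body with boundary `sevenQuads i`. -/
def quadBody (i : Fin 7) : Set ℂ := {z | quadGauge i z ≤ 1}

lemma convex_quadBody (i : Fin 7) : Convex ℝ (quadBody i) := by
  have : quadBody i = ⋂ e, {z | sideForm i e z ≤ 1} := by
    ext z; simp [quadBody, quadGauge_le_iff]
  rw [this]
  exact convex_iInter fun e => convex_halfSpace_le (sideForm i e).isLinear 1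

lemma isCompact_quadBody (i : Fin 7) : IsCompact (quadBody i) := by
  refine Metric.isCompact_of_isClosed_isBounded
    (isClosed_le (continuous_quadGauge i) continuous_const) ?_
  refine isBounded_iff_forall_norm_le.2 ⟨2, fun z hz => ?_⟩
  have := norm_le_quadGauge i z
  have : quadGauge i z ≤ 1 := hz
  linarith

/-- A point of gauge 1 leaves the body when scaled by any factor above 1, so it is not interior. -/
lemma interior_quadBody (i : Fin 7) : interior (quadBody i) = {z | quadGauge i z < 1} := by
  apply subset_antisymm
  · intro z hz
    by_contra hz'
    have h1 : quadGauge i z = 1 := le_antisymm (interior_subset (s := quadBody i) hz) (not_lt.1 hz')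
    have hcont : Filter.Tendsto (fun t : ℝ => t • z) (nhdsWithin 1 (Set.Ioi 1)) (nhds z) := by
      have : Continuous fun t : ℝ => t • z := by fun_prop
      simpa using (this.tendsto 1).mono_left nhdsWithin_le_nhds
    have h2 := hcont.eventually (mem_interior_iff_mem_nhds.1 hz)
    obtain ⟨t, ht, ht'⟩ := (h2.and self_mem_nhdsWithin).exists
    have h3 : quadGauge i (t • z) ≤ 1 := ht
    have ht1 : 1 < t := ht'
    rw [quadGauge_smul i (by linarith), h1] at h3
    linarith
  · refine interior_maximal (fun z hz => ?_) (isOpen_lt (continuous_quadGauge i) continuous_const)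
    exact le_of_lt (show quadGauge i z < 1 from hz)

lemma frontier_quadBody (i : Fin 7) : frontier (quadBody i) = {z | quadGauge i z = 1} := by
  rw [(isCompact_quadBody i).isClosed.frontier_eq, interior_quadBody]
  ext z
  simp only [quadBody, Set.mem_sdiff, Set.mem_ofPred_eq, not_lt]
  exact ⟨fun h => le_antisymm h.1 h.2, fun h => ⟨h.le, h.ge⟩⟩

lemma mem_curveInterior_quad {i : Fin 7} {z : ℂ} :
    z ∈ curveInterior {z | quadGauge i z = 1} ↔ quadGauge i z < 1 := by
  rw [← frontier_quadBody, curveInterior_frontier (convex_quadBody i) (isCompact_quadBody i),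
    interior_quadBody]
  rfl

lemma mem_curveExterior_quad {i : Fin 7} {z : ℂ} :
    z ∈ curveExterior {z | quadGauge i z = 1} ↔ 1 < quadGauge i z := by
  rw [← frontier_quadBody, curveExterior_frontier (convex_quadBody i) (isCompact_quadBody i)]
  simp [quadBody]

/-- The curve is the radial projection of the unit circle. -/
lemma isSimpleClosedCurve_quad (i : Fin 7) : IsSimpleClosedCurve {z | quadGauge i z = 1} := by
  have hpos (u : Circle) : 0 < quadGauge i u := quadGauge_pos i u.coe_ne_zero
  refine ⟨fun u => (quadGauge i u)⁻¹ • (u : ℂ), ?_, ?_, ?_⟩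
  · have h : Continuous fun u : Circle => quadGauge i u :=
      (continuous_quadGauge i).comp continuous_subtype_val
    exact (h.inv₀ fun u => (hpos u).ne').smul continuous_subtype_val
  · intro u v huv
    have huv' : (quadGauge i u)⁻¹ • (u : ℂ) = (quadGauge i v)⁻¹ • (v : ℂ) := huv
    have hn := congrArg norm huv'
    rw [norm_smul, norm_smul, Circle.norm_coe, Circle.norm_coe, mul_one, mul_one,
      Real.norm_of_nonneg (inv_nonneg.2 (hpos u).le),
      Real.norm_of_nonneg (inv_nonneg.2 (hpos v).le)] at hn
    rw [hn] at huv'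
    exact Subtype.ext (smul_right_injective ℂ (inv_ne_zero (hpos v).ne') huv')
  · ext z
    constructor
    · rintro ⟨u, rfl⟩
      show quadGauge i _ = 1
      rw [quadGauge_smul i (inv_nonneg.2 (hpos u).le), inv_mul_cancel₀ (hpos u).ne']
    · intro hz
      have hz1 : quadGauge i z = 1 := hz
      have hz0 : z ≠ 0 := by
        rintro rfl
        rw [quadGauge_zero] at hz1
        exact zero_ne_one hz1
      have hz2 : z = ‖z‖ • (Circle.exp z.arg : ℂ) := by
        rw [Circle.coe_exp, Complex.real_smul, Complex.norm_mul_exp_arg_mul_I]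
      refine ⟨Circle.exp z.arg, ?_⟩
      have h1 : ‖z‖ * quadGauge i (Circle.exp z.arg) = 1 := by
        rw [← quadGauge_smul i (norm_nonneg z), ← hz2, hz1]
      show (quadGauge i (Circle.exp z.arg))⁻¹ • (Circle.exp z.arg : ℂ) = z
      rw [← eq_inv_of_mul_eq_one_left h1, ← hz2]

end Gauge

/-! ### The level sets of the gauges as convex polygons, and their symmetry. -/

section Polygon

/-- The image of a polygon under a map. -/
def mapPolygon {n : ℕ} (f : ℂ → ℂ) (p : Polygon ℂ n) : Polygon ℂ n := ⟨f ∘ p.vertices⟩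

lemma boundary_mapPolygon {n : ℕ} (f : ℂ →ₗ[ℝ] ℂ) (p : Polygon ℂ n) :
    (mapPolygon f p).boundary ℝ = f '' p.boundary ℝ := by
  simp only [Polygon.boundary, Polygon.edgeSet, Set.image_iUnion]
  refine Set.iUnion_congr fun i => ?_
  exact (affineSegment_image f.toAffineMap (p i) (p (finRotate n i))).symm

lemma IsConvexPolygon.map {n : ℕ} {p : Polygon ℂ n} (hp : IsConvexPolygon p)
    (f : ℂ ≃L[ℝ] ℂ) : IsConvexPolygon (mapPolygon f p) where
  three_le := hp.three_le
  convexIndependent := by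
    intro s x hx
    refine hp.convexIndependent s x ?_
    have h : (mapPolygon f p).vertices '' s = f '' (p.vertices '' s) :=
      Set.image_comp f p.vertices s
    rw [h, show (f : ℂ → ℂ) = (f : ℂ →ₗ[ℝ] ℂ) from rfl, ← LinearMap.image_convexHull] at hx
    exact (f.injective.mem_set_image).1 hx
  boundary_eq := by
    have h1 := boundary_mapPolygon (f : ℂ →ₗ[ℝ] ℂ) p
    have h : Set.range (mapPolygon f p).vertices = f '' Set.range p.vertices :=
      Set.range_comp f p.vertices
    rw [h, show (f : ℂ → ℂ) = (f : ℂ →ₗ[ℝ] ℂ) from rfl, ← LinearMap.image_convexHull]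
    refine h1.trans ?_
    rw [hp.boundary_eq]
    exact f.toHomeomorph.image_frontier _

/-- Row `e` has its two ones at the ends of the side `e`; all other entries are negative, which
yields strict convexity. -/
lemma sideForm_quad (e : Fin 4) (k : Fin 4) : sideForm 0 e (quad.vertices k) =
    ![![1, 1, -322370 / 193118, -110600 / 193118],
      ![-220324 / 295164, 1, 1, -410736 / 295164],
      ![-173940 / 320190, -385710 / 320190, 1, 1],
      ![1, -102572 / 201146, -292984 / 201146, 1]] e k := by
  rw [sideForm_zero_apply]
  fin_cases e <;> fin_cases k <;> norm_num [sideNormal, quad]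

lemma sideForm_quad_le (e : Fin 4) (k : Fin 4) : sideForm 0 e (quad.vertices k) ≤ 1 := by
  rw [sideForm_quad]
  fin_cases e <;> fin_cases k <;> norm_num

lemma quad_vertices_mem_quadBody (k : Fin 4) : quad.vertices k ∈ quadBody 0 :=
  quadGauge_le_iff.2 fun e => sideForm_quad_le e k

lemma edge_subset (e : Fin 4) : quad.edgeSet ℝ e ⊆ {z | quadGauge 0 z = 1} := by
  rintro _ ⟨t, ht, rfl⟩
  have hmem : AffineMap.lineMap (quad.vertices e) (quad.vertices (finRotate 4 e)) t ∈ quadBody 0 :=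
    (convex_quadBody 0).lineMap_mem (quad_vertices_mem_quadBody _)
      (quad_vertices_mem_quadBody _) ht
  refine le_antisymm hmem ?_
  refine le_trans (le_of_eq ?_) (sideForm_le_quadGauge 0 e _)
  rw [AffineMap.lineMap_apply_module, map_add, map_smul, map_smul, sideForm_quad, sideForm_quad]
  fin_cases e <;> simp

lemma mem_edge_of_sideForm_eq_one {e : Fin 4} {z : ℂ} (hz : z ∈ quadBody 0)
    (he : sideForm 0 e z = 1) : z ∈ quad.edgeSet ℝ e := by
  have h := quadGauge_le_iff.1 (show quadGauge 0 z ≤ 1 from hz)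
  have h0 := h 0
  have h1 := h 1
  have h2 := h 2
  have h3 := h 3
  suffices H : ∃ t ∈ Set.Icc (0 : ℝ) 1,
      z.re = (1 - t) * (quad.vertices e).re + t * (quad.vertices (finRotate 4 e)).re ∧
      z.im = (1 - t) * (quad.vertices e).im + t * (quad.vertices (finRotate 4 e)).im by
    obtain ⟨t, ht, hre, him⟩ := H
    refine ⟨t, ht, ?_⟩
    rw [AffineMap.lineMap_apply_module]
    apply Complex.ext
    · simpa using hre.symm
    · simpa using him.symm
  fin_cases e
  · simp [sideForm_zero_apply, sideNormal, quad] at *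
    -- The parameter is read off the real part: 0.323 is the difference of the abscissae of the two
    -- ends. The forms of the neighbouring sides keep it in the unit interval.
    refine ⟨(z.re + 0.446) / 0.323, ⟨?_, ?_⟩, ?_, ?_⟩
    · rw [le_div_iff₀ (by norm_num)]; linarith
    · rw [div_le_iff₀ (by norm_num)]; linarith
    · ring
    · ring_nf at he ⊢; linarith
  · simp [sideForm_zero_apply, sideNormal, quad] at *
    refine ⟨(z.re + 0.123) / 0.822, ⟨?_, ?_⟩, ?_, ?_⟩
    · rw [le_div_iff₀ (by norm_num)]; linarith
    · rw [div_le_iff₀ (by norm_num)]; linarith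
    · ring
    · ring_nf at he ⊢; linarith
  · simp [sideForm_zero_apply, sideNormal, quad] at *
    refine ⟨(0.699 - z.re) / 0.78, ⟨?_, ?_⟩, ?_, ?_⟩
    · rw [le_div_iff₀ (by norm_num)]; linarith
    · rw [div_le_iff₀ (by norm_num)]; linarith
    · ring
    · ring_nf at he ⊢; linarith
  · simp [sideForm_zero_apply, sideNormal, quad] at *
    refine ⟨(-0.081 - z.re) / 0.365, ⟨?_, ?_⟩, ?_, ?_⟩
    · rw [le_div_iff₀ (by norm_num)]; linarith
    · rw [div_le_iff₀ (by norm_num)]; linarith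
    · ring
    · ring_nf at he ⊢; linarith

lemma boundary_quad : quad.boundary ℝ = {z | quadGauge 0 z = 1} := by
  apply subset_antisymm
  · exact Set.iUnion_subset edge_subset
  · intro z hz
    have hz1 : quadGauge 0 z = 1 := hz
    obtain ⟨e, he⟩ := exists_sideForm_eq 0 z
    exact Set.mem_iUnion.2 ⟨e, mem_edge_of_sideForm_eq_one hz1.le (he.symm.trans hz1)⟩

/-- A nonzero point of the body lies between the origin and its radial projection to the boundary,
and the boundary lies in the hull, being made of sides. -/
lemma convexHull_quad : convexHull ℝ (Set.range quad.vertices) = quadBody 0 := by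
  apply subset_antisymm
  · refine convexHull_min ?_ (convex_quadBody 0)
    rintro _ ⟨k, rfl⟩
    exact quad_vertices_mem_quadBody k
  · have hb : {z | quadGauge 0 z = 1} ⊆ convexHull ℝ (Set.range quad.vertices) := by
      rw [← boundary_quad]
      refine Set.iUnion_subset fun e => ?_
      rw [Polygon.edgeSet, affineSegment_eq_segment]
      exact (convex_convexHull ℝ _).segment_subset (subset_convexHull ℝ _ ⟨_, rfl⟩)
        (subset_convexHull ℝ _ ⟨_, rfl⟩)
    have hn (y : ℂ) (hy : y ≠ 0) :
        (quadGauge 0 y)⁻¹ • y ∈ convexHull ℝ (Set.range quad.vertices) := by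
      have h := quadGauge_pos 0 hy
      apply hb
      show quadGauge 0 _ = 1
      rw [quadGauge_smul 0 (inv_nonneg.2 h.le), inv_mul_cancel₀ h.ne']
    have h0 : (0 : ℂ) ∈ convexHull ℝ (Set.range quad.vertices) := by
      have hp := quadGauge_pos 0 (one_ne_zero (α := ℂ))
      have hm := quadGauge_pos 0 (neg_ne_zero.2 (one_ne_zero (α := ℂ)))
      -- The origin lies between the two boundary points on the real axis; weights proportional to
      -- the gauges cancel them.
      have := (convex_convexHull ℝ (Set.range quad.vertices)) (hn 1 one_ne_zero)
        (hn (-1) (by simp)) (a := quadGauge 0 1 / (quadGauge 0 1 + quadGauge 0 (-1)))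
        (b := quadGauge 0 (-1) / (quadGauge 0 1 + quadGauge 0 (-1)))
        (by positivity) (by positivity) (by field_simp)
      convert this using 1
      rw [smul_smul, smul_smul, smul_neg, div_mul_eq_mul_div, div_mul_eq_mul_div,
        mul_inv_cancel₀ hp.ne', mul_inv_cancel₀ hm.ne', add_neg_cancel]
    intro z hz
    rcases eq_or_ne z 0 with rfl | hz0
    · exact h0
    · have h := quadGauge_pos 0 hz0
      have := (convex_convexHull ℝ (Set.range quad.vertices)).smul_mem_of_zero_mem h0 (hn z hz0)
        ⟨h.le, hz⟩
      rwa [smul_smul, mul_inv_cancel₀ h.ne', one_smul] at this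

lemma isConvexPolygon_quad : IsConvexPolygon quad where
  three_le := by norm_num
  boundary_eq := by rw [convexHull_quad, frontier_quadBody, boundary_quad]
  convexIndependent := by
    intro s k hk
    by_contra hks
    -- the sum of the forms of the two sides at a vertex takes its maximum only there
    have hsub : quad.vertices '' s ⊆
        {z | (sideForm 0 k + sideForm 0 ((finRotate 4).symm k)) z < 2} := by
      rintro _ ⟨j, hj, rfl⟩
      have hjk : j ≠ k := fun h => hks (h ▸ hj)
      show sideForm 0 k _ + sideForm 0 _ _ < 2
      rw [sideForm_quad, sideForm_quad]
      fin_cases k <;> fin_cases j <;> simp at hjk ⊢ <;> norm_num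
    have hmem := convexHull_min hsub (convex_halfSpace_lt
      (sideForm 0 k + sideForm 0 ((finRotate 4).symm k)).toLinearMap.isLinear 2) hk
    have h2 : sideForm 0 k (quad.vertices k) +
        sideForm 0 ((finRotate 4).symm k) (quad.vertices k) < 2 := hmem
    rw [sideForm_quad, sideForm_quad] at h2
    revert h2
    fin_cases k <;> simp <;> norm_num

/-- The rotation about the origin that carries the first quadrilateral to the `i`-th. -/
noncomputable def turnEquiv (i : Fin 7) : ℂ ≃ₗᵢ[ℝ] ℂ := rotation (Circle.exp (turn i))

lemma turnEquiv_apply (i : Fin 7) (z : ℂ) :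
    turnEquiv i z = Complex.exp (turn i * Complex.I) * z := by
  simp [turnEquiv, rotation_apply]

lemma sevenQuads_eq_image (i : Fin 7) : sevenQuads i = turnEquiv i '' quad.boundary ℝ := by
  refine Set.image_congr fun z _ => ?_
  rw [turnEquiv_apply, rotationAbout, turn]
  simp

lemma sevenQuads_eq (i : Fin 7) : sevenQuads i = {z | quadGauge i z = 1} := by
  rw [sevenQuads_eq_image, boundary_quad]
  ext z
  constructor
  · rintro ⟨y, hy, rfl⟩
    show quadGauge i _ = 1
    rw [turnEquiv_apply, quadGauge_rotation]
    exact hy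
  · intro hz
    obtain ⟨y, rfl⟩ := (turnEquiv i).surjective z
    refine ⟨y, ?_, rfl⟩
    rw [turnEquiv_apply] at hz
    show quadGauge 0 y = 1
    rw [← quadGauge_rotation i y]
    exact hz

lemma isKGon_sevenQuads (i : Fin 7) : IsKGon 4 (sevenQuads i) := by
  refine ⟨mapPolygon (turnEquiv i).toContinuousLinearEquiv quad,
    isConvexPolygon_quad.map (turnEquiv i).toContinuousLinearEquiv, ?_⟩
  rw [sevenQuads_eq_image]
  exact boundary_mapPolygon ((turnEquiv i).toContinuousLinearEquiv : ℂ →ₗ[ℝ] ℂ) quad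

lemma isCongruent_sevenQuads (i j : Fin 7) : IsCongruent (sevenQuads i) (sevenQuads j) := by
  refine ⟨(turnEquiv i).toIsometryEquiv.symm.trans (turnEquiv j).toIsometryEquiv, ?_⟩
  rw [sevenQuads_eq_image, sevenQuads_eq_image, Set.image_image]
  refine Set.image_congr fun z _ => ?_
  simp

lemma isRotationallySymmetric_sevenQuads : IsRotationallySymmetric 0 sevenQuads := by
  intro i
  rw [sevenQuads, sevenQuads, Set.image_image]
  refine Set.image_congr fun z _ => ?_
  simp only [rotationAbout, sub_zero, zero_add]
  rw [← mul_assoc, ← Complex.exp_add]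
  congr 1
  have hval : ((finRotate 7 i : Fin 7) : ℕ) = (i : ℕ) + 1 ∨
      ((finRotate 7 i : Fin 7) : ℕ) = 0 ∧ (i : ℕ) = 6 := by
    fin_cases i <;> simp
  rcases hval with h | ⟨h, h'⟩
  · rw [h]
    congr 1
    push_cast
    ring
  · rw [h, h', Complex.exp_eq_exp_iff_exists_int]
    refine ⟨-1, ?_⟩
    push_cast
    ring

end Polygon

/-! ### From integer certificates to inequalities between gauges on cones. -/

section Sectors

set_option maxHeartbeats 4000000 in
-- The trigonometric approximations are within `1 / 10 ^ 7` and the coordinates of each normal have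
-- moduli adding up to less than 5. After scaling, this contributes less than 1/2; the rest is
-- rounding.
lemma approxNormal_spec (i : Fin 7) (e : Fin 4) :
    |10 ^ 6 * ((sideNormal e).1 * Real.cos (turn i) - (sideNormal e).2 * Real.sin (turn i)) -
      (approxNormal i e).1| ≤ 2 ∧
    |10 ^ 6 * ((sideNormal e).1 * Real.sin (turn i) + (sideNormal e).2 * Real.cos (turn i)) -
      (approxNormal i e).2| ≤ 2 := by
  obtain ⟨hc, hs⟩ := cosApprox_sinApprox i
  generalize Real.cos (turn i) = c at hc ⊢
  generalize Real.sin (turn i) = s at hs ⊢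
  rw [abs_le] at hc hs
  obtain ⟨hc1, hc2⟩ := hc
  obtain ⟨hs1, hs2⟩ := hs
  simp only [abs_le]
  fin_cases i <;> fin_cases e <;>
    norm_num [approxNormal, approxNormals, sideNormal, cosApprox, sinApprox]
      at hc1 hc2 hs1 hs2 ⊢ <;>
    refine ⟨⟨?_, ?_⟩, ?_, ?_⟩ <;> linarith

/-- The direction as a point of the plane. -/
def Direction.point (d : Direction) : ℂ := ⟨d.x, d.y⟩

lemma abs_sideForm_sub_value_le (d : Direction) (i : Fin 7) (e : Fin 4) :
    |10 ^ 6 * sideForm i e d.point - (d.value i e : ℝ)| ≤ 2 * (|(d.x : ℝ)| + |(d.y : ℝ)|) := by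
  obtain ⟨h1, h2⟩ := approxNormal_spec i e
  rw [sideForm_apply, Direction.value, Direction.point]
  set a := (sideNormal e).1 * Real.cos (turn i) - (sideNormal e).2 * Real.sin (turn i)
  set b := (sideNormal e).1 * Real.sin (turn i) + (sideNormal e).2 * Real.cos (turn i)
  push_cast
  calc
    _ = |(10 ^ 6 * a - (approxNormal i e).1) * d.x +
          (10 ^ 6 * b - (approxNormal i e).2) * d.y| := by
        congr 1; ring
    _ ≤ |10 ^ 6 * a - (approxNormal i e).1| * |(d.x : ℝ)| +
        |10 ^ 6 * b - (approxNormal i e).2| * |(d.y : ℝ)| := by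
        rw [← abs_mul, ← abs_mul]; exact abs_add_le _ _
    _ ≤ 2 * |(d.x : ℝ)| + 2 * |(d.y : ℝ)| := by gcongr
    _ = _ := by ring

/-- Each value is off by at most 2 * 50000, so a difference of two is off by at most `valueMargin`.
-/
lemma sideForm_lt_of_value {d : Direction} (hd : |d.x| + |d.y| ≤ 50000) {i j : Fin 7}
    {e f : Fin 4} (h : valueMargin < d.value j f - d.value i e) :
    sideForm i e d.point < sideForm j f d.point := by
  have h1 := (abs_le.1 (abs_sideForm_sub_value_le d i e)).2
  have h2 := (abs_le.1 (abs_sideForm_sub_value_le d j f)).1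
  have hd' : |(d.x : ℝ)| + |(d.y : ℝ)| ≤ 50000 := by exact_mod_cast hd
  have h' : (200000 : ℝ) < d.value j f - d.value i e := by exact_mod_cast h
  linarith

/-- The closed cone spanned by `u` and `v`, without its apex. -/
def sector (u v : ℂ) : Set ℂ := {z | ∃ s t : ℝ, 0 ≤ s ∧ 0 ≤ t ∧ 0 < s + t ∧ z = s • u + t • v}

lemma convex_sector (u v : ℂ) : Convex ℝ (sector u v) := by
  rintro _ ⟨s, t, hs, ht, hst, rfl⟩ _ ⟨s', t', hs', ht', hst', rfl⟩ a b ha hb hab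
  refine ⟨a * s + b * s', a * t + b * t', by positivity, by positivity, ?_, ?_⟩
  · rcases ha.eq_or_lt with rfl | ha
    · have : b = 1 := by linarith
      subst this
      linarith
    · have := mul_pos ha hst
      have := mul_nonneg hb hst'.le
      linarith
  · module

lemma left_mem_sector (u v : ℂ) : u ∈ sector u v :=
  ⟨1, 0, zero_le_one, le_rfl, by norm_num, by simp⟩

lemma right_mem_sector (u v : ℂ) : v ∈ sector u v :=
  ⟨0, 1, le_rfl, zero_le_one, by norm_num, by simp⟩

/-- This is why the certificates inspect only the two bounding rays. -/
lemma lt_on_sector {u v z : ℂ} (hz : z ∈ sector u v) {f g : ℂ →L[ℝ] ℝ} (hu : f u < g u)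
    (hv : f v < g v) : f z < g z := by
  obtain ⟨s, t, hs, ht, hst, rfl⟩ := hz
  simp only [map_add, map_smul, smul_eq_mul]
  rcases hs.eq_or_lt with rfl | hs
  · have ht' : 0 < t := by linarith
    have := mul_lt_mul_of_pos_left hv ht'
    linarith
  · have := mul_lt_mul_of_pos_left hu hs
    have := mul_le_mul_of_nonneg_left hv.le ht
    linarith

lemma CertifiedBelow.lt {d d' : Direction} (hd : |d.x| + |d.y| ≤ 50000)
    (hd' : |d'.x| + |d'.y| ≤ 50000) {i j : Fin 7} (h : CertifiedBelow d d' i j) {z : ℂ}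
    (hz : z ∈ sector d.point d'.point) : quadGauge i z < quadGauge j z := by
  obtain ⟨e, he⟩ := h
  refine lt_of_lt_of_le (quadGauge_lt_iff.2 fun f => ?_) (sideForm_le_quadGauge j e z)
  exact lt_on_sector hz (sideForm_lt_of_value hd (he f).1) (sideForm_lt_of_value hd' (he f).2)

lemma CertifiedLinear.eq {d d' : Direction} (hd : |d.x| + |d.y| ≤ 50000)
    (hd' : |d'.x| + |d'.y| ≤ 50000) {i : Fin 7} {e : Fin 4} (h : CertifiedLinear d d' i e) {z : ℂ}
    (hz : z ∈ sector d.point d'.point) : quadGauge i z = sideForm i e z := by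
  refine le_antisymm (quadGauge_le_iff.2 fun f => ?_) (sideForm_le_quadGauge i e z)
  rcases h f with rfl | ⟨h1, h2⟩
  · exact le_rfl
  · exact (lt_on_sector hz (sideForm_lt_of_value hd h1) (sideForm_lt_of_value hd' h2)).le

end Sectors

/-! ### The cyclic sequence of orders and the sets of curves of least gauge. -/

section Cyclic

/-- The directions in cyclic order. -/
def ray (k : Fin sectorCount) : Direction := direction k

lemma cyclic_induction {P : Fin sectorCount → Prop} (k : Fin sectorCount) (h0 : P k)
    (hs : ∀ l, P l → P (l + 1)) (l : Fin sectorCount) : P l := by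
  have h (j : Fin (132 + 1)) : P (k + j) := by
    induction j using Fin.induction with
    | zero => rwa [add_zero]
    | succ j ih =>
      have := hs _ ih
      rwa [add_assoc, Fin.coeSucc_eq_succ] at this
  simpa using h (l - k)

/-- The index 133 in the list is the repeated first direction, which is the cyclic index 0. -/
lemma direction_val_add_one (k : Fin sectorCount) : direction (k + 1 : ℕ) = ray (k + 1) := by
  rw [ray]
  by_cases h : (k : ℕ) + 1 < sectorCount
  · congr 1
    rw [Fin.val_add_one_of_lt' h]
  · have hk : (k : ℕ) = 132 := by
      have := k.isLt
      simp only [sectorCount] at *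
      omega
    have hk' : k + 1 = 0 := by
      apply Fin.ext
      rw [Fin.val_add, hk]
      rfl
    rw [hk', hk]
    rfl

lemma certifiedSector_ray (k : Fin sectorCount) : CertifiedSector (ray k) (ray (k + 1)) := by
  rw [← direction_val_add_one]
  have hl : directions.length = 134 := rfl
  have hk : (k : ℕ) < 133 := k.isLt
  have h1 : (k : ℕ) < (directions.zip directions.tail).length := by
    rw [List.length_zip, List.length_tail, hl]
    omega
  have := certifiedSector_zip _ (List.getElem_mem h1)
  rw [List.getElem_zip, List.getElem_tail] at this
  rw [ray, direction, direction, List.getD_eq_getElem _ _ (by omega),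
    List.getD_eq_getElem _ _ (by omega)]
  exact this

lemma ray_bound (k : Fin sectorCount) : |(ray k).x| + |(ray k).y| ≤ 50000 :=
  (certifiedSector_ray k).1.2

/-- The point of the plane on the `k`-th ray. -/
def rayPoint (k : Fin sectorCount) : ℂ := (ray k).point

/-- The `k`-th sector. -/
def raySector (k : Fin sectorCount) : Set ℂ := sector (rayPoint k) (rayPoint (k + 1))

/-- In each sector, two curves keep their order, or they are the curves that cross there and are
straight. -/
lemma order_on_raySector (k : Fin sectorCount) {i j : Fin 7}
    (h : (ray k).rank i < (ray k).rank j) :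
    ((ray (k + 1)).rank i < (ray (k + 1)).rank j ∧
      ∀ z ∈ raySector k, quadGauge i z < quadGauge j z) ∨
    (i = (ray k).fst ∧ j = (ray k).snd ∧ (ray (k + 1)).rank j + 1 = (ray (k + 1)).rank i ∧
      ∃ e f, (∀ z ∈ raySector k, quadGauge i z = sideForm i e z) ∧
        (∀ z ∈ raySector k, quadGauge j z = sideForm j f z) ∧
        sideForm i e (rayPoint k) < sideForm j f (rayPoint k) ∧
        sideForm j f (rayPoint (k + 1)) < sideForm i e (rayPoint (k + 1))) := by
  rcases (certifiedSector_ray k).2.2 i j h with ⟨h1, h2⟩ | ⟨h1, h2, h3, e, f, ⟨h4, h5⟩, h6, h7⟩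
  · exact Or.inl ⟨h1, fun z hz => h2.lt (ray_bound _) (ray_bound _) hz⟩
  · exact Or.inr ⟨h1, h2, h3, e, f, fun z hz => h6.eq (ray_bound _) (ray_bound _) hz,
      fun z hz => h7.eq (ray_bound _) (ray_bound _) hz, sideForm_lt_of_value (ray_bound _) h4,
      sideForm_lt_of_value (ray_bound _) h5⟩

lemma rank_lt_or_gt (k : Fin sectorCount) {i j : Fin 7} (h : i ≠ j) :
    (ray k).rank i < (ray k).rank j ∨ (ray k).rank j < (ray k).rank i :=
  lt_or_gt_of_ne ((certifiedSector_ray k).2.1 i j h)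

lemma quadGauge_rayPoint_lt (k : Fin sectorCount) {i j : Fin 7}
    (h : (ray k).rank i < (ray k).rank j) :
    quadGauge i (rayPoint k) < quadGauge j (rayPoint k) := by
  have hz : rayPoint k ∈ raySector k := left_mem_sector _ _
  rcases order_on_raySector k h with ⟨-, h⟩ | ⟨-, -, -, e, f, h1, h2, h3, -⟩
  · exact h _ hz
  · rwa [h1 _ hz, h2 _ hz]

/-- The cone of the directions in which the curves of `S` are met before the others. -/
def innerCone (S : Set (Fin 7)) : Set ℂ :=
  {z | ∀ i ∈ S, ∀ j ∉ S, quadGauge i z < quadGauge j z}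

/-- On the `k`-th ray, the curves of `S` are met before the others. -/
def InnerAt (S : Set (Fin 7)) (k : Fin sectorCount) : Prop :=
  ∀ i ∈ S, ∀ j ∉ S, (ray k).rank i < (ray k).rank j

lemma InnerAt.rayPoint_mem {S : Set (Fin 7)} {k : Fin sectorCount} (h : InnerAt S k) :
    rayPoint k ∈ innerCone S :=
  fun i hi j hj => quadGauge_rayPoint_lt k (h i hi j hj)

/-- Within a sector, each defining inequality either holds or fails throughout, or it compares the
crossing pair, whose gauges are linear there, and then cuts out a half-plane. -/
lemma convex_innerCone_inter (S : Set (Fin 7)) (k : Fin sectorCount) :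
    Convex ℝ (innerCone S ∩ raySector k) := by
  intro y ⟨hyS, hyk⟩ z ⟨hzS, hzk⟩ a b ha hb hab
  have hk : a • y + b • z ∈ raySector k := convex_sector _ _ hyk hzk ha hb hab
  refine ⟨fun i hi j hj => ?_, hk⟩
  have hy := hyS i hi j hj
  have hz := hzS i hi j hj
  have key (e f : Fin 4) (h1 : ∀ z ∈ raySector k, quadGauge i z = sideForm i e z)
      (h2 : ∀ z ∈ raySector k, quadGauge j z = sideForm j f z) :
      quadGauge i (a • y + b • z) < quadGauge j (a • y + b • z) := by
    rw [h1 _ hyk, h2 _ hyk] at hy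
    rw [h1 _ hzk, h2 _ hzk] at hz
    rw [h1 _ hk, h2 _ hk]
    have := (convex_halfSpace_lt (sideForm i e - sideForm j f).toLinearMap.isLinear 0)
      (show _ < (0 : ℝ) from sub_neg.2 hy) (show _ < (0 : ℝ) from sub_neg.2 hz) ha hb hab
    exact sub_neg.1 (show (sideForm i e - sideForm j f) (a • y + b • z) < 0 from this)
  rcases rank_lt_or_gt k (show i ≠ j from fun h => hj (h ▸ hi)) with h | h
  · rcases order_on_raySector k h with ⟨-, h⟩ | ⟨-, -, -, e, f, h1, h2, -⟩
    · exact h _ hk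
    · exact key e f h1 h2
  · rcases order_on_raySector k h with ⟨-, h⟩ | ⟨-, -, -, e, f, h1, h2, -⟩
    · exact absurd (h y hyk) hy.not_gt
    · exact key f e h2 h1

/-- A pair in the wrong order on the first ray must be the crossing pair, with `snd` in `S` and
`fst` outside. A pair in the wrong order on the second ray must also be the crossing pair, but with
`fst` in `S`. -/
lemma innerAt_or_innerAt {S : Set (Fin 7)} {k : Fin sectorCount} {z : ℂ}
    (hz : z ∈ innerCone S) (hk : z ∈ raySector k) : InnerAt S k ∨ InnerAt S (k + 1) := by
  by_contra! h
  obtain ⟨h1, h2⟩ := h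
  simp only [InnerAt, not_forall, not_lt] at h1 h2
  obtain ⟨i, hi, j, hj, h1⟩ := h1
  obtain ⟨i', hi', j', hj', h2⟩ := h2
  have hij : j ≠ i := fun h => hj (h ▸ hi)
  have hij' : j' ≠ i' := fun h => hj' (h ▸ hi')
  rcases order_on_raySector k (lt_of_le_of_ne h1 ((certifiedSector_ray k).2.1 _ _ hij))
    with ⟨-, h⟩ | ⟨hjf, his, -⟩
  · exact (hz i hi j hj).not_gt (h z hk)
  · rcases rank_lt_or_gt k hij' with h3 | h3
    · rcases order_on_raySector k h3 with ⟨-, h⟩ | ⟨-, -, h, -⟩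
      · exact (hz i' hi' j' hj').not_gt (h z hk)
      · omega
    · rcases order_on_raySector k h3 with ⟨h, -⟩ | ⟨h, -⟩
      · omega
      · exact hj (hjf ▸ h ▸ hi')

/-- The set of the innermost curves that first occurs behind the `k`-th sector. -/
def newSet (k : Fin sectorCount) : Set (Fin 7) :=
  {i | (ray (k + 1)).rank i ≤ (ray (k + 1)).rank (ray k).snd}

/-- Only the crossing can repair the order, so `S` contains `snd` but not `fst`. These have
consecutive ranks behind the sector, so the initial segment `S` ends exactly at `snd`. -/
lemma eq_newSet {S : Set (Fin 7)} {k : Fin sectorCount} (h : ¬ InnerAt S k)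
    (h' : InnerAt S (k + 1)) : (ray k).fst ≠ (ray k).snd ∧ S = newSet k := by
  simp only [InnerAt, not_forall, not_lt] at h
  obtain ⟨i, hi, j, hj, h⟩ := h
  have hij : j ≠ i := fun h => hj (h ▸ hi)
  have h1 := h' i hi j hj
  rcases order_on_raySector k (lt_of_le_of_ne h ((certifiedSector_ray k).2.1 _ _ hij))
    with ⟨h2, -⟩ | ⟨hjf, his, h2, -⟩
  · omega
  · refine ⟨fun h => hij (hjf.trans (h.trans his.symm)), ?_⟩
    ext x
    rw [newSet, Set.mem_ofPred_eq, ← his]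
    constructor
    · intro hx
      have := h' x hx j hj
      omega
    · intro hx
      by_contra hx'
      exact (h' i hi x hx').not_ge hx

lemma newMask_eq (k : Fin sectorCount) : newMask (direction (k + 1 : ℕ)) (direction k).snd =
    Nat.ofBits fun i : Fin 7 => decide ((ray (k + 1)).rank i ≤ (ray (k + 1)).rank (ray k).snd) := by
  rw [direction_val_add_one]
  rfl

lemma newSet_injective {k l : Fin sectorCount} (hk : (ray k).fst ≠ (ray k).snd)
    (hl : (ray l).fst ≠ (ray l).snd) (h : newSet k = newSet l) : k = l := by
  have h1 := firstSectors_newMask k hk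
  have h2 := firstSectors_newMask l hl
  rw [newMask_eq] at h1 h2
  have : (fun i : Fin 7 => decide ((ray (k + 1)).rank i ≤ (ray (k + 1)).rank (ray k).snd)) =
      fun i : Fin 7 => decide ((ray (l + 1)).rank i ≤ (ray (l + 1)).rank (ray l).snd) := by
    funext i
    exact decide_eq_decide.2 (Set.ext_iff.1 h i)
  rw [this, h2] at h1
  exact Fin.ext h1.symm

lemma exists_eq_newSet {S : Set (Fin 7)} (h : S.Nonempty) (h' : Sᶜ.Nonempty) :
    ∃ k, (ray k).fst ≠ (ray k).snd ∧ S = newSet k := by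
  classical
  set m := Nat.ofBits fun i : Fin 7 => decide (i ∈ S) with hm
  have hbit (i : Fin 7) : m.testBit i = decide (i ∈ S) := by
    rw [hm, Nat.testBit_ofBits_lt _ _ i.isLt]
  have hlt : m < 128 := Nat.ofBits_lt_two_pow _
  obtain ⟨h1, h2, h3⟩ := newMask_firstSectors ⟨m, hlt⟩
    (fun h0 => by
      obtain ⟨i, hi⟩ := h
      have := hbit i
      rw [show m = 0 from congrArg Fin.val h0] at this
      simp [hi] at this)
    (fun h0 => by
      obtain ⟨i, hi⟩ := h'
      have := hbit i
      rw [show m = 127 from congrArg Fin.val h0] at this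
      rw [decide_eq_false hi] at this
      revert this
      fin_cases i <;> decide)
  set k : Fin sectorCount := ⟨_, h1⟩ with hk
  refine ⟨k, h2, ?_⟩
  have h4 := (newMask_eq k).symm.trans h3
  ext i
  have h5 := hbit i
  rw [show m = _ from h4.symm, Nat.testBit_ofBits_lt _ _ i.isLt] at h5
  exact (decide_eq_decide.1 h5).symm

lemma innerAt_newSet {k : Fin sectorCount} : InnerAt (newSet k) (k + 1) := by
  intro i hi j hj
  have hi' : (ray (k + 1)).rank i ≤ (ray (k + 1)).rank (ray k).snd := hi
  have hj' : ¬ (ray (k + 1)).rank j ≤ (ray (k + 1)).rank (ray k).snd := hj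
  omega

/-- The coefficients are those of Cramer's rule. -/
lemma mem_sector_of_cross {u v z : ℂ} (h : 0 < u.re * v.im - u.im * v.re)
    (h1 : 0 ≤ u.re * z.im - u.im * z.re) (h2 : v.re * z.im - v.im * z.re ≤ 0) (hz : z ≠ 0) :
    z ∈ sector u v := by
  have hD := h.ne'
  have hrep : z = (-(v.re * z.im - v.im * z.re) / (u.re * v.im - u.im * v.re)) • u +
      ((u.re * z.im - u.im * z.re) / (u.re * v.im - u.im * v.re)) • v := by
    apply Complex.ext
    · simp only [Complex.add_re, Complex.smul_re, smul_eq_mul]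
      rw [div_mul_eq_mul_div, div_mul_eq_mul_div, ← add_div, eq_div_iff hD]
      ring
    · simp only [Complex.add_im, Complex.smul_im, smul_eq_mul]
      rw [div_mul_eq_mul_div, div_mul_eq_mul_div, ← add_div, eq_div_iff hD]
      ring
  have hs : 0 ≤ -(v.re * z.im - v.im * z.re) / (u.re * v.im - u.im * v.re) :=
    div_nonneg (by linarith) h.le
  have ht : 0 ≤ (u.re * z.im - u.im * z.re) / (u.re * v.im - u.im * v.re) := div_nonneg h1 h.le
  refine ⟨_, _, hs, ht, ?_, hrep⟩
  refine lt_of_le_of_ne (add_nonneg hs ht) fun h0 => hz ?_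
  obtain ⟨e1, e2⟩ := (add_eq_zero_iff_of_nonneg hs ht).1 h0.symm
  rw [hrep, e1, e2]
  simp

/-- If `z` avoids all sectors, lying weakly to the left of one ray puts it strictly to the left of
the next, hence of all. The rays 0, 44 and 89 surround the origin, so `z` can be neither to the left
of all three nor to the right of all three. -/
lemma exists_mem_raySector {z : ℂ} (hz : z ≠ 0) : ∃ k, z ∈ raySector k := by
  by_contra! hno
  have hstep (k : Fin sectorCount)
      (h : 0 ≤ (rayPoint k).re * z.im - (rayPoint k).im * z.re) :
      0 < (rayPoint (k + 1)).re * z.im - (rayPoint (k + 1)).im * z.re := by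
    by_contra! h'
    have hc := (certifiedSector_ray k).1.1
    refine hno k (mem_sector_of_cross ?_ h h' hz)
    have hc' : (0 : ℝ) < (ray k).x * (ray (k + 1)).y - (ray k).y * (ray (k + 1)).x := by
      exact_mod_cast hc
    exact hc'
  have hall (k l : Fin sectorCount)
      (h : 0 ≤ (rayPoint k).re * z.im - (rayPoint k).im * z.re) :
      0 < (rayPoint l).re * z.im - (rayPoint l).im * z.re :=
    cyclic_induction
      (P := fun l => 0 < (rayPoint l).re * z.im - (rayPoint l).im * z.re) (k + 1) (hstep k h)
      (fun l hl => hstep l hl.le) l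
  have hpt (k : Fin sectorCount) (x y : ℤ) (hx : (ray k).x = x) (hy : (ray k).y = y) :
      rayPoint k = ⟨x, y⟩ := by
    rw [rayPoint, Direction.point, hx, hy]
  have e0 := hpt 0 30000 0 (by decide +kernel) (by decide +kernel)
  have e1 := hpt 44 (-15399) 25747 (by decide +kernel) (by decide +kernel)
  have e2 := hpt 89 (-14694) (-26155) (by decide +kernel) (by decide +kernel)
  have h0 := hall 0 0
  have h1 := hall 0 44
  have h2 := hall 0 89
  have h3 := hall 44 0
  have h4 := hall 89 0
  rw [e0] at h0 h1 h2 h3 h4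
  rw [e1] at h1 h3
  rw [e2] at h2 h4
  push_cast at h0 h1 h2 h3 h4
  rcases le_or_gt 0 (30000 * z.im - 0 * z.re) with h | h
  · have := h0 h
    have := h1 h
    have := h2 h
    linarith
  · have := lt_of_not_ge fun h' => (h3 h').not_gt h
    have := lt_of_not_ge fun h' => (h4 h').not_gt h
    linarith

end Cyclic

/-! ### The seven quadrilaterals form a simple Venn diagram. -/

section SevenQuads

lemma ne_zero_of_mem_innerCone {S : Set (Fin 7)} (h : S.Nonempty) (h' : Sᶜ.Nonempty) {z : ℂ}
    (hz : z ∈ innerCone S) : z ≠ 0 := by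
  rintro rfl
  obtain ⟨i, hi⟩ := h
  obtain ⟨j, hj⟩ := h'
  have := hz i hi j hj
  simp [quadGauge_zero] at this

/-- Consecutive rays on which `S` is an initial segment are joined by the convex piece of the cone
in the sector between them, and there is a single run of such rays. Any other point of the cone
shares a convex piece with one of these rays. -/
lemma isConnected_innerCone {S : Set (Fin 7)} (h : S.Nonempty) (h' : Sᶜ.Nonempty) :
    IsConnected (innerCone S) := by
  obtain ⟨k, hk, hSk⟩ := exists_eq_newSet h h'
  have hgood : InnerAt S (k + 1) := hSk ▸ innerAt_newSet
  set K := connectedComponentIn (innerCone S) (rayPoint (k + 1)) with hK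
  have hext {y z : ℂ} {l : Fin sectorCount} (hy : y ∈ K) (hyl : y ∈ raySector l)
      (hz : z ∈ innerCone S) (hzl : z ∈ raySector l) : z ∈ K := by
    have hyS := connectedComponentIn_subset _ _ hy
    have hsub := (convex_innerCone_inter S l).isPreconnected.subset_connectedComponentIn
      ⟨hyS, hyl⟩ Set.inter_subset_left
    rw [hK, connectedComponentIn_eq hy]
    exact hsub ⟨hz, hzl⟩
  have hall (l : Fin sectorCount) : InnerAt S l → rayPoint l ∈ K := by
    refine cyclic_induction (P := fun l => InnerAt S l → rayPoint l ∈ K) (k + 1)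
      (fun _ => mem_connectedComponentIn hgood.rayPoint_mem) (fun l ih hl => ?_) l
    by_cases hl' : InnerAt S l
    · exact hext (ih hl') (left_mem_sector _ _) hl.rayPoint_mem (right_mem_sector _ _)
    -- Here `S` becomes an initial segment anew; this happens behind one sector only, so the ray is
    -- the starting one.
    · obtain ⟨h1, h2⟩ := eq_newSet hl' hl
      rw [newSet_injective h1 hk (h2.symm.trans hSk)]
      exact mem_connectedComponentIn hgood.rayPoint_mem
  have hKeq : K = innerCone S := by
    refine subset_antisymm (connectedComponentIn_subset _ _) fun z hz => ?_
    obtain ⟨l, hl⟩ := exists_mem_raySector (ne_zero_of_mem_innerCone h h' hz)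
    rcases innerAt_or_innerAt hz hl with hg | hg
    · exact hext (hall l hg) (left_mem_sector _ _) hz hl
    · exact hext (hall _ hg) (right_mem_sector _ _) hz hl
  exact ⟨⟨_, hgood.rayPoint_mem⟩, hKeq ▸ isPreconnected_connectedComponentIn⟩

lemma mem_region_sevenQuads {S : Set (Fin 7)} {z : ℂ} : z ∈ region sevenQuads S ↔
    (∀ i ∈ S, quadGauge i z < 1) ∧ ∀ j ∉ S, 1 < quadGauge j z := by
  simp only [region, sevenQuads_eq, Set.mem_inter_iff, Set.mem_iInter, Set.mem_compl_iff,
    mem_curveInterior_quad, mem_curveExterior_quad]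

lemma continuous_sup'_quadGauge (s : Finset (Fin 7)) (hs : s.Nonempty) :
    Continuous fun z => s.sup' hs fun i => quadGauge i z :=
  Continuous.finset_sup'_apply _ fun i _ => continuous_quadGauge i

lemma continuous_inf'_quadGauge (s : Finset (Fin 7)) (hs : s.Nonempty) :
    Continuous fun z => s.inf' hs fun i => quadGauge i z :=
  Continuous.finset_inf'_apply _ fun i _ => continuous_quadGauge i

/-- With `a` the largest gauge in `S` and `b` the smallest outside, a positive multiple of `z` lies
in the region exactly when its factor is between 1/b and 1/a. This exhibits the region as a
continuous image of the cone times an interval. -/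
lemma isConnected_region_of_nonempty {S : Set (Fin 7)} (h : S.Nonempty) (h' : Sᶜ.Nonempty) :
    IsConnected (region sevenQuads S) := by
  classical
  set s : Finset (Fin 7) := Finset.univ.filter (· ∈ S) with hs
  set s' : Finset (Fin 7) := Finset.univ.filter (· ∉ S) with hs'
  have hsn : s.Nonempty := by obtain ⟨i, hi⟩ := h; exact ⟨i, by simpa [hs] using hi⟩
  have hsn' : s'.Nonempty := by obtain ⟨i, hi⟩ := h'; exact ⟨i, by simpa [hs'] using hi⟩
  set a : ℂ → ℝ := fun z => s.sup' hsn fun i => quadGauge i z with ha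
  set b : ℂ → ℝ := fun z => s'.inf' hsn' fun i => quadGauge i z with hb
  have ha_cont : Continuous a := continuous_sup'_quadGauge s hsn
  have hb_cont : Continuous b := continuous_inf'_quadGauge s' hsn'
  have ha_lt {z : ℂ} {r : ℝ} : a z < r ↔ ∀ i ∈ S, quadGauge i z < r := by
    simp [ha, Finset.sup'_lt_iff, hs]
  have hb_lt {z : ℂ} {r : ℝ} : r < b z ↔ ∀ i ∉ S, r < quadGauge i z := by
    simp [hb, Finset.lt_inf'_iff, hs']
  have hab {z : ℂ} (hz : z ∈ innerCone S) : a z < b z :=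
    hb_lt.2 fun j hj => ha_lt.2 fun i hi => hz i hi j hj
  have ha_pos {z : ℂ} (hz : z ≠ 0) : 0 < a z := by
    obtain ⟨i, hi⟩ := hsn
    exact (quadGauge_pos i hz).trans_le (Finset.le_sup' (fun i => quadGauge i z) hi)
  have hm_pos {z : ℂ} {t : ℝ} (hz : z ∈ innerCone S) (ht : t ∈ Set.Ioo (0 : ℝ) 1) :
      0 < (1 - t) * a z + t * b z := by
    have h1 := ha_pos (ne_zero_of_mem_innerCone h h' hz)
    have h2 := h1.trans (hab hz)
    have := mul_pos (sub_pos.2 ht.2) h1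
    have := mul_pos ht.1 h2
    linarith
  set F : ℂ × ℝ → ℂ := fun p => ((1 - p.2) * a p.1 + p.2 * b p.1)⁻¹ • p.1 with hF
  have himage : F '' (innerCone S ×ˢ Set.Ioo 0 1) = region sevenQuads S := by
    ext w
    rw [mem_region_sevenQuads]
    constructor
    · rintro ⟨⟨z, t⟩, ⟨hz, ht⟩, rfl⟩
      have hz : z ∈ innerCone S := hz
      have ht : t ∈ Set.Ioo (0 : ℝ) 1 := ht
      have hm := hm_pos hz ht
      have hlt := hab hz
      simp only [hF]
      constructor
      · intro i hi
        rw [quadGauge_smul i (inv_nonneg.2 hm.le), inv_mul_lt_iff₀ hm, mul_one]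
        refine lt_of_le_of_lt (Finset.le_sup' (fun i => quadGauge i z)
          (show i ∈ s by simpa [hs] using hi)) (show a z < _ from ?_)
        have := mul_pos ht.1 (sub_pos.2 hlt)
        linarith
      · intro j hj
        rw [quadGauge_smul j (inv_nonneg.2 hm.le), lt_inv_mul_iff₀ hm, mul_one]
        refine lt_of_lt_of_le (show _ < b z from ?_) (Finset.inf'_le (fun i => quadGauge i z)
          (show j ∈ s' by simpa [hs'] using hj))
        have := mul_pos (sub_pos.2 ht.2) (sub_pos.2 hlt)
        linarith
    · rintro ⟨h1, h2⟩
      have h1' : a w < 1 := ha_lt.2 h1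
      have h2' : 1 < b w := hb_lt.2 h2
      have hlt : 0 < b w - a w := by linarith
      -- The parameter that makes the denominator 1, so that `w` is its own image.
      refine ⟨(w, (1 - a w) / (b w - a w)), ⟨fun i hi j hj => (h1 i hi).trans (h2 j hj),
        div_pos (by linarith) hlt, (div_lt_one hlt).2 (by linarith)⟩, ?_⟩
      have : (1 - (1 - a w) / (b w - a w)) * a w + (1 - a w) / (b w - a w) * b w = 1 := by
        field_simp
        ring
      simp only [hF]
      rw [this, inv_one, one_smul]
  rw [← himage]
  refine ((isConnected_innerCone h h').prod ((isConnected_Ioo zero_lt_one))).image F ?_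
  refine ContinuousOn.smul (ContinuousOn.inv₀ ?_ fun p hp => (hm_pos hp.1 hp.2).ne')
    continuous_fst.continuousOn
  fun_prop

/-- Here the smallest gauge alone decides: the region is an image of the punctured plane times (1,
∞). -/
lemma isConnected_region_empty : IsConnected (region sevenQuads ∅) := by
  set b : ℂ → ℝ := fun z => Finset.univ.inf' Finset.univ_nonempty fun i : Fin 7 => quadGauge i z
    with hb
  have hb_cont : Continuous b := continuous_inf'_quadGauge _ _
  have hb_lt {z : ℂ} {r : ℝ} : r < b z ↔ ∀ i, r < quadGauge i z := by
    simp [hb, Finset.lt_inf'_iff]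
  have hb_pos {z : ℂ} (hz : z ≠ 0) : 0 < b z := hb_lt.2 fun i => quadGauge_pos i hz
  set F : ℂ × ℝ → ℂ := fun p => (p.2 * (b p.1)⁻¹) • p.1 with hF
  have himage : F '' ({0}ᶜ ×ˢ Set.Ioi 1) = region sevenQuads ∅ := by
    ext w
    rw [mem_region_sevenQuads]
    simp only [Set.mem_empty_iff_false, false_imp_iff, implies_true, true_and, not_false_eq_true,
      forall_const]
    constructor
    · rintro ⟨⟨z, t⟩, ⟨hz, ht⟩, rfl⟩ j
      have hz : z ≠ 0 := hz
      have ht : 1 < t := ht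
      have hm := hb_pos hz
      simp only [hF]
      rw [quadGauge_smul j (by positivity), mul_assoc]
      have : 1 ≤ (b z)⁻¹ * quadGauge j z := by
        rw [le_inv_mul_iff₀ hm, mul_one]
        exact Finset.inf'_le (fun i => quadGauge i z) (Finset.mem_univ j)
      nlinarith
    · intro hw
      have hw0 : w ≠ 0 := by
        rintro rfl
        have := hw 0
        rw [quadGauge_zero] at this
        linarith
      refine ⟨(w, b w), ⟨hw0, hb_lt.2 hw⟩, ?_⟩
      simp only [hF]
      rw [mul_inv_cancel₀ (hb_pos hw0).ne', one_smul]
  rw [← himage]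
  have h0 : IsConnected ({0}ᶜ : Set ℂ) :=
    isConnected_compl_singleton_of_one_lt_rank (by rw [Complex.rank_real_complex]; norm_num) 0
  refine (h0.prod isConnected_Ioi).image F ?_
  refine ContinuousOn.smul (continuous_snd.continuousOn.mul
    (ContinuousOn.inv₀ ?_ fun p hp => (hb_pos hp.1).ne')) continuous_fst.continuousOn
  fun_prop

lemma isConnected_region_univ : IsConnected (region sevenQuads Set.univ) := by
  have h : region sevenQuads Set.univ = ⋂ (i : Fin 7) (e : Fin 4), {z | sideForm i e z < 1} := by
    ext z
    rw [mem_region_sevenQuads]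
    simp [quadGauge_lt_iff]
  refine ⟨⟨0, mem_region_sevenQuads.2 ⟨fun i _ => ?_, fun j hj => absurd (Set.mem_univ j) hj⟩⟩, ?_⟩
  · rw [quadGauge_zero]
    exact zero_lt_one
  · rw [h]
    exact (convex_iInter fun i => convex_iInter fun e =>
      convex_halfSpace_lt (sideForm i e).toLinearMap.isLinear 1).isPreconnected

lemma isConnected_region_sevenQuads (S : Set (Fin 7)) : IsConnected (region sevenQuads S) := by
  rcases S.eq_empty_or_nonempty with rfl | h
  · exact isConnected_region_empty
  rcases Sᶜ.eq_empty_or_nonempty with h' | h'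
  · rw [Set.compl_empty_iff.1 h']
    exact isConnected_region_univ
  · exact isConnected_region_of_nonempty h h'

/-- Curves that meet in a sector cross there and are straight. -/
lemma crossing_of_quadGauge_eq {k : Fin sectorCount} {i j : Fin 7} (hij : i ≠ j) {z : ℂ}
    (hz : z ∈ raySector k) (h : quadGauge i z = quadGauge j z) :
    (i = (ray k).fst ∧ j = (ray k).snd ∨ j = (ray k).fst ∧ i = (ray k).snd) ∧
    ∃ e f, (∀ z ∈ raySector k, quadGauge i z = sideForm i e z) ∧
      (∀ z ∈ raySector k, quadGauge j z = sideForm j f z) ∧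
      0 < (sideForm i e (rayPoint k) - sideForm j f (rayPoint k)) *
        (sideForm j f (rayPoint (k + 1)) - sideForm i e (rayPoint (k + 1))) := by
  rcases rank_lt_or_gt k hij with hr | hr
  · rcases order_on_raySector k hr with ⟨-, h'⟩ | ⟨h1, h2, -, e, f, h3, h4, h5, h6⟩
    · exact absurd h (h' z hz).ne
    · exact ⟨Or.inl ⟨h1, h2⟩, e, f, h3, h4, mul_pos_of_neg_of_neg (sub_neg.2 h5) (sub_neg.2 h6)⟩
  · rcases order_on_raySector k hr with ⟨-, h'⟩ | ⟨h1, h2, -, e, f, h3, h4, h5, h6⟩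
    · exact absurd h.symm (h' z hz).ne
    · exact ⟨Or.inr ⟨h1, h2⟩, f, e, h4, h3, mul_pos (sub_pos.2 h5) (sub_pos.2 h6)⟩

/-- The two forms differ on the first ray, so their equality fixes the ratio of the cone
coordinates; the common value 1 fixes the scale. -/
lemma subsingleton_inter_raySector {i j : Fin 7} (hij : i ≠ j) (k : Fin sectorCount) :
    ({z | quadGauge i z = 1} ∩ {z | quadGauge j z = 1} ∩ raySector k).Subsingleton := by
  rintro y ⟨⟨hyi, hyj⟩, hyk⟩ z ⟨⟨hzi, hzj⟩, hzk⟩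
  have hyi : quadGauge i y = 1 := hyi
  have hyj : quadGauge j y = 1 := hyj
  have hzi : quadGauge i z = 1 := hzi
  have hzj : quadGauge j z = 1 := hzj
  obtain ⟨-, e, f, he, hf, hpos⟩ := crossing_of_quadGauge_eq hij hyk (hyi.trans hyj.symm)
  rw [he y hyk] at hyi
  rw [hf y hyk] at hyj
  rw [he z hzk] at hzi
  rw [hf z hzk] at hzj
  obtain ⟨s, t, hs, ht, hst, rfl⟩ := hyk
  obtain ⟨s', t', hs', ht', hst', rfl⟩ := hzk
  simp only [map_add, map_smul, smul_eq_mul] at hyi hyj hzi hzj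
  generalize sideForm i e (rayPoint k) = a at *
  generalize sideForm j f (rayPoint k) = b at *
  generalize sideForm i e (rayPoint (k + 1)) = c at *
  generalize sideForm j f (rayPoint (k + 1)) = d at *
  have hp : a - b ≠ 0 := left_ne_zero_of_mul hpos.ne'
  have h1 : s * t' = s' * t := by
    refine mul_left_cancel₀ hp ?_
    linear_combination t' * (hyi - hyj) - t * (hzi - hzj)
  have h2 : s = s' := by linear_combination s' * hyi - s * hzi + c * h1
  have h3 : t = t' := by linear_combination t' * hyi - t * hzi - a * h1
  rw [h2, h3]

lemma finite_inter_sevenQuads {i j : Fin 7} (hij : i ≠ j) :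
    (sevenQuads i ∩ sevenQuads j).Finite := by
  rw [sevenQuads_eq, sevenQuads_eq]
  have h : {z | quadGauge i z = 1} ∩ {z | quadGauge j z = 1} ⊆
      ⋃ k, {z | quadGauge i z = 1} ∩ {z | quadGauge j z = 1} ∩ raySector k := by
    rintro z hz
    have hz0 : z ≠ 0 := by
      rintro rfl
      have : quadGauge i 0 = 1 := hz.1
      rw [quadGauge_zero] at this
      exact zero_ne_one this
    obtain ⟨k, hk⟩ := exists_mem_raySector hz0
    exact Set.mem_iUnion.2 ⟨k, hz, hk⟩
  exact (Set.finite_iUnion fun k => (subsingleton_inter_raySector hij k).finite).subset h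

lemma isVennDiagram_sevenQuads : IsVennDiagram sevenQuads where
  simpleClosedCurve i := sevenQuads_eq i ▸ isSimpleClosedCurve_quad i
  finite_inter _ _ hij := finite_inter_sevenQuads hij
  region_connected := isConnected_region_sevenQuads

/-- Three curves through a point would give two distinct crossing pairs in one sector. -/
lemma isSimpleFamily_sevenQuads : IsSimpleFamily sevenQuads := by
  intro z
  rcases eq_or_ne z 0 with rfl | hz
  · have : {i | (0 : ℂ) ∈ sevenQuads i} = ∅ := by
      ext i
      simp [sevenQuads_eq, quadGauge_zero]
    rw [this, Set.ncard_empty]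
    exact Nat.zero_le _
  · obtain ⟨k, hk⟩ := exists_mem_raySector hz
    by_contra! h
    obtain ⟨i, hi, j, hj, l, hl, hij, hil, hjl⟩ := (Set.two_lt_ncard).1 h
    simp only [sevenQuads_eq, Set.mem_ofPred_eq] at hi hj hl
    have h1 := (crossing_of_quadGauge_eq hij hk (hi.trans hj.symm)).1
    have h2 := (crossing_of_quadGauge_eq hil hk (hi.trans hl.symm)).1
    rcases h1 with ⟨a, b⟩ | ⟨a, b⟩ <;> rcases h2 with ⟨c, d⟩ | ⟨c, d⟩
    · exact hjl (b.trans d.symm)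
    · exact hij (d.trans b.symm)
    · exact hij (c.trans a.symm)
    · exact hjl (a.trans c.symm)

end SevenQuads

/-! ### Intersection numbers of two triangles. -/

section Triangles

lemma lineMap_mem_openSegment (a b : ℂ) {r s t : ℝ} (hrs : r < s) (hst : s < t) :
    AffineMap.lineMap a b s ∈
      openSegment ℝ (AffineMap.lineMap a b r) (AffineMap.lineMap a b t : ℂ) := by
  rw [← image_openSegment ℝ (AffineMap.lineMap a b : ℝ →ᵃ[ℝ] ℂ), openSegment_eq_Ioo (hrs.trans hst)]
  exact ⟨s, ⟨hrs, hst⟩, rfl⟩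

/-- A segment that has only finitely many points in common with the frontier of a convex set has no
frontier point strictly between two points of the set. -/
lemma not_mem_frontier_between {K : Set ℂ} (hK : Convex ℝ K) {a b : ℂ}
    (hab : a ≠ b) (hfin : (segment ℝ a b ∩ frontier K).Finite) {r s t : ℝ} (hr : 0 ≤ r)
    (hrs : r < s) (hst : s < t) (ht : t ≤ 1) (h1 : AffineMap.lineMap a b r ∈ K)
    (h2 : AffineMap.lineMap a b s ∈ frontier K) (h3 : AffineMap.lineMap a b t ∈ K) : False := by
  have hsub : AffineMap.lineMap a b '' Set.Ioo r t ⊆ segment ℝ a b ∩ frontier K := by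
    rintro _ ⟨x, ⟨hx1, hx2⟩, rfl⟩
    refine ⟨?_, subset_closure (hK.openSegment_subset h1 h3 (lineMap_mem_openSegment a b hx1 hx2)),
      fun hx => ?_⟩
    · rw [segment_eq_image_lineMap]
      exact ⟨x, ⟨by linarith, by linarith⟩, rfl⟩
    · rcases lt_trichotomy x s with hxs | rfl | hxs
      · exact h2.2 (hK.openSegment_interior_self_subset_interior hx h3
          (lineMap_mem_openSegment a b hxs hst))
      · exact h2.2 hx
      · exact h2.2 (hK.openSegment_self_interior_subset_interior h1 hx
          (lineMap_mem_openSegment a b hrs hxs))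
  exact (Set.Ioo_infinite (hrs.trans hst)).image
    ((AffineMap.lineMap_injective ℝ hab).injOn) (hfin.subset hsub)

/-- The segment from `a` to `b` without `b`. -/
def halfOpenSegment (a b : ℂ) : Set ℂ := AffineMap.lineMap a b '' Set.Ico (0 : ℝ) 1

lemma halfOpenSegment_subset (a b : ℂ) : halfOpenSegment a b ⊆ segment ℝ a b := by
  rw [segment_eq_image_lineMap]
  exact Set.image_mono Set.Ico_subset_Icc_self

lemma ncard_halfOpenSegment_inter_le_two {K : Set ℂ} (hK : Convex ℝ K) (hc : IsClosed K) {a b : ℂ}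
    (hab : a ≠ b) (hfin : (segment ℝ a b ∩ frontier K).Finite) :
    (halfOpenSegment a b ∩ frontier K).ncard ≤ 2 := by
  by_contra! h
  have hfin' := hfin.subset (Set.inter_subset_inter_left (frontier K) (halfOpenSegment_subset a b))
  obtain ⟨_, ⟨⟨x, hx, rfl⟩, hxK⟩, _, ⟨⟨y, hy, rfl⟩, hyK⟩, _, ⟨⟨z, hz, rfl⟩, hzK⟩, hxy, hxz, hyz⟩ :=
    (Set.two_lt_ncard hfin').1 h
  have key {r s t : ℝ} (hr : r ∈ Set.Ico (0 : ℝ) 1) (ht : t ∈ Set.Ico (0 : ℝ) 1)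
      (hrK : AffineMap.lineMap a b r ∈ frontier K) (hsK : AffineMap.lineMap a b s ∈ frontier K)
      (htK : AffineMap.lineMap a b t ∈ frontier K) (hrs : r < s) (hst : s < t) : False :=
    not_mem_frontier_between hK hab hfin hr.1 hrs hst ht.2.le (hc.frontier_subset hrK) hsK
      (hc.frontier_subset htK)
  have hxy' : x ≠ y := fun h => hxy (by rw [h])
  have hxz' : x ≠ z := fun h => hxz (by rw [h])
  have hyz' : y ≠ z := fun h => hyz (by rw [h])
  rcases lt_or_gt_of_ne hxy' with h1 | h1 <;> rcases lt_or_gt_of_ne hyz' with h2 | h2 <;>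
    rcases lt_or_gt_of_ne hxz' with h3 | h3
  · exact key hx hz hxK hyK hzK h1 h2
  · exact key hx hz hxK hyK hzK h1 h2
  · exact key hx hy hxK hzK hyK h3 h2
  · exact key hz hy hzK hxK hyK h3 h1
  · exact key hy hz hyK hxK hzK h1 h3
  · exact key hy hx hyK hzK hxK h2 h3
  · exact key hz hx hzK hyK hxK h2 h1
  · exact key hz hx hzK hyK hxK h2 h1

/-- The end `b` serves as the third point. It may itself lie on the frontier, and is then left to
the next side; hence the half-open segments. -/
lemma ncard_halfOpenSegment_inter_le_one {K : Set ℂ} (hK : Convex ℝ K) (hc : IsClosed K) {a b : ℂ}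
    (hab : a ≠ b) (hfin : (segment ℝ a b ∩ frontier K).Finite) (hb : b ∈ K) :
    (halfOpenSegment a b ∩ frontier K).ncard ≤ 1 := by
  by_contra! h
  have hfin' := hfin.subset (Set.inter_subset_inter_left (frontier K) (halfOpenSegment_subset a b))
  obtain ⟨_, ⟨⟨x, hx, rfl⟩, hxK⟩, _, ⟨⟨y, hy, rfl⟩, hyK⟩, hxy⟩ := (Set.one_lt_ncard hfin').1 h
  have hb' : AffineMap.lineMap a b (1 : ℝ) ∈ K := by rwa [AffineMap.lineMap_apply_one]
  have hxy' : x ≠ y := fun h => hxy (by rw [h])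
  rcases lt_or_gt_of_ne hxy' with h1 | h1
  · exact not_mem_frontier_between hK hab hfin hx.1 h1 hy.2 le_rfl (hc.frontier_subset hxK)
      hyK hb'
  · exact not_mem_frontier_between hK hab hfin hy.1 h1 hx.2 le_rfl (hc.frontier_subset hyK)
      hxK hb'

/-- The corners `v` are those of a triangle with the union of the three sides as its boundary. -/
structure IsTriangle (v : Fin 3 → ℂ) : Prop where
  injective : Function.Injective v
  frontier_eq : frontier (convexHull ℝ (Set.range v)) = ⋃ e, segment ℝ (v e) (v (e + 1))

lemma isCompact_triangle (v : Fin 3 → ℂ) :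
    IsCompact (convexHull ℝ (Set.range v)) :=
  (Set.finite_range v).isCompact_convexHull ℝ

lemma isClosed_triangle (v : Fin 3 → ℂ) :
    IsClosed (convexHull ℝ (Set.range v)) :=
  (isCompact_triangle v).isClosed

namespace IsTriangle

variable {v w : Fin 3 → ℂ}

lemma ne_add_one (hv : IsTriangle v) (e : Fin 3) : v e ≠ v (e + 1) :=
  hv.injective.ne (by fin_cases e <;> decide)

lemma segment_subset_frontier (hv : IsTriangle v) (e : Fin 3) :
    segment ℝ (v e) (v (e + 1)) ⊆ frontier (convexHull ℝ (Set.range v)) := by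
  rw [hv.frontier_eq]
  exact Set.subset_iUnion (fun e => segment ℝ (v e) (v (e + 1))) e

lemma frontier_eq_halfOpen (hv : IsTriangle v) :
    frontier (convexHull ℝ (Set.range v)) = ⋃ e, halfOpenSegment (v e) (v (e + 1)) := by
  rw [hv.frontier_eq]
  refine subset_antisymm (Set.iUnion_subset fun e => ?_)
    (Set.iUnion_mono fun e => halfOpenSegment_subset _ _)
  rw [segment_eq_image_lineMap]
  rintro _ ⟨t, ht, rfl⟩
  rcases ht.2.eq_or_lt with rfl | h
  · refine Set.mem_iUnion.2 ⟨e + 1, 0, ⟨le_rfl, zero_lt_one⟩, ?_⟩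
    simp
  · exact Set.mem_iUnion.2 ⟨e, t, ⟨ht.1, h⟩, rfl⟩

lemma ncard_inter_le_sum (hv : IsTriangle v) (D : Set ℂ) :
    (frontier (convexHull ℝ (Set.range v)) ∩ D).ncard ≤
      ∑ e, (halfOpenSegment (v e) (v (e + 1)) ∩ D).ncard := by
  rw [hv.frontier_eq_halfOpen, Set.iUnion_inter, Fin.sum_univ_three]
  have : (⋃ e : Fin 3, halfOpenSegment (v e) (v (e + 1)) ∩ D) =
      halfOpenSegment (v 0) (v (0 + 1)) ∩ D ∪ halfOpenSegment (v 1) (v (1 + 1)) ∩ D ∪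
        halfOpenSegment (v 2) (v (2 + 1)) ∩ D := by
    ext z
    simp only [Set.mem_iUnion, Set.mem_union]
    constructor
    · rintro ⟨i, hi⟩
      fin_cases i
      exacts [Or.inl (Or.inl hi), Or.inl (Or.inr hi), Or.inr hi]
    · rintro ((h | h) | h)
      exacts [⟨0, h⟩, ⟨1, h⟩, ⟨2, h⟩]
  rw [this]
  exact (Set.ncard_union_le _ _).trans (Nat.add_le_add_right (Set.ncard_union_le _ _) _)

lemma finite_segment_inter (hv : IsTriangle v)
    (hfin : (frontier (convexHull ℝ (Set.range v)) ∩
      frontier (convexHull ℝ (Set.range w))).Finite) (e : Fin 3) :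
    (segment ℝ (v e) (v (e + 1)) ∩ frontier (convexHull ℝ (Set.range w))).Finite :=
  hfin.subset (Set.inter_subset_inter_left _ (hv.segment_subset_frontier e))

lemma ncard_side_le_two (hv : IsTriangle v)
    (hfin : (frontier (convexHull ℝ (Set.range v)) ∩
      frontier (convexHull ℝ (Set.range w))).Finite) (e : Fin 3) :
    (halfOpenSegment (v e) (v (e + 1)) ∩ frontier (convexHull ℝ (Set.range w))).ncard ≤ 2 :=
  ncard_halfOpenSegment_inter_le_two (convex_convexHull ℝ _) (isClosed_triangle w)
    (hv.ne_add_one e) (hv.finite_segment_inter hfin e)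

open scoped Classical in
/-- Two triangles meet in at most six points, less the number of corners of the first in the
second. -/
lemma ncard_inter_add_le (hv : IsTriangle v)
    (hfin : (frontier (convexHull ℝ (Set.range v)) ∩
      frontier (convexHull ℝ (Set.range w))).Finite) :
    (frontier (convexHull ℝ (Set.range v)) ∩ frontier (convexHull ℝ (Set.range w))).ncard +
      ∑ e, (if v e ∈ convexHull ℝ (Set.range w) then 1 else 0) ≤ 6 := by
  have h1 := hv.ncard_inter_le_sum (frontier (convexHull ℝ (Set.range w)))
  -- The corner charged here is the excluded end of the side, so the sum over the sides charges each
  -- corner once.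
  have h2 (e : Fin 3) :
      (halfOpenSegment (v e) (v (e + 1)) ∩ frontier (convexHull ℝ (Set.range w))).ncard +
        (if v (e + 1) ∈ convexHull ℝ (Set.range w) then 1 else 0) ≤ 2 := by
    split_ifs with h
    · exact Nat.succ_le_succ (ncard_halfOpenSegment_inter_le_one (convex_convexHull ℝ _)
        (isClosed_triangle w) (hv.ne_add_one e) (hv.finite_segment_inter hfin e) h)
    · exact hv.ncard_side_le_two hfin e
  have h3 := h2 0
  have h4 := h2 1
  have h5 := h2 2
  rw [Fin.sum_univ_three] at h1 ⊢
  simp only [zero_add, show (1 : Fin 3) + 1 = 2 from rfl, show (2 : Fin 3) + 1 = 0 from rfl]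
    at h1 h3 h4 h5
  omega

end IsTriangle

end Triangles

/-! ### Chords of a triangle that separate two of its corners. -/

section Chords

/-- The signed area of the parallelogram spanned by two vectors. -/
def area (a b : ℂ) : ℝ := a.re * b.im - a.im * b.re

lemma continuous_area_sub (d q : ℂ) : Continuous fun z => area d (z - q) := by
  unfold area
  fun_prop

lemma exists_real_of_area_eq_zero {d z : ℂ} (hd : d ≠ 0) (h : area d z = 0) :
    ∃ t : ℝ, z = t • d := by
  have hn : d.re * d.re + d.im * d.im ≠ 0 := by
    intro h0
    apply hd
    apply Complex.ext
    · simp only [Complex.zero_re]; nlinarith [mul_self_nonneg d.re, mul_self_nonneg d.im]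
    · simp only [Complex.zero_im]; nlinarith [mul_self_nonneg d.re, mul_self_nonneg d.im]
  refine ⟨(d.re * z.re + d.im * z.im) / (d.re * d.re + d.im * d.im), ?_⟩
  unfold area at h
  apply Complex.ext
  · simp only [Complex.smul_re, smul_eq_mul]
    rw [div_mul_eq_mul_div, eq_div_iff hn]
    linear_combination -d.im * h
  · simp only [Complex.smul_im, smul_eq_mul]
    rw [div_mul_eq_mul_div, eq_div_iff hn]
    linear_combination d.re * h

/-- A line through an interior point of a convex set and two of its frontier points has the
interior point between them. -/
lemma mem_segment_of_area_eq_zero {K : Set ℂ} (hK : Convex ℝ K) (hc : IsClosed K) {q q' z : ℂ}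
    (hq : q ∈ frontier K) (hq' : q' ∈ frontier K) (hne : q ≠ q') (hz : z ∈ interior K)
    (h : area (q' - q) (z - q) = 0) : z ∈ segment ℝ q q' := by
  obtain ⟨t, ht⟩ := exists_real_of_area_eq_zero (sub_ne_zero.2 hne.symm) h
  have hz' : AffineMap.lineMap q q' t = z := by
    rw [AffineMap.lineMap_apply_module', ← ht, sub_add_cancel]
  rw [segment_eq_image_lineMap]
  refine ⟨t, ⟨?_, ?_⟩, hz'⟩
  · by_contra! h0
    have := lineMap_mem_openSegment q q' h0 zero_lt_one
    rw [hz', AffineMap.lineMap_apply_zero, AffineMap.lineMap_apply_one] at this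
    exact hq.2 (hK.openSegment_interior_self_subset_interior hz (hc.frontier_subset hq') this)
  · by_contra! h0
    have := lineMap_mem_openSegment q q' zero_lt_one h0
    rw [hz', AffineMap.lineMap_apply_zero, AffineMap.lineMap_apply_one] at this
    exact hq'.2 (hK.openSegment_self_interior_subset_interior (hc.frontier_subset hq) hz this)

/-- Otherwise the hull lies on one line, while an interior point can be moved perpendicularly to it.
-/
lemma area_ne_zero_of_interior_nonempty {v : Fin 3 → ℂ} (hv : IsTriangle v)
    (hne : (interior (convexHull ℝ (Set.range v))).Nonempty) (e : Fin 3) :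
    area (v (e + 1) - v e) (v (e + 2) - v e) ≠ 0 := by
  intro h
  set d := v (e + 1) - v e with hd
  have hd0 : d ≠ 0 := sub_ne_zero.2 (hv.ne_add_one e).symm
  have hall : ∀ i, area d (v i - v e) = 0 := by
    intro i
    obtain rfl | rfl | rfl : i = e ∨ i = e + 1 ∨ i = e + 2 := by
      fin_cases e <;> fin_cases i <;> decide
    · simp [area]
    · simp only [area, hd]; ring
    · exact h
  have hconv : Convex ℝ {z | area d (z - v e) = 0} := by
    intro y hy z hz a b _ _ hab
    have hy : area d (y - v e) = 0 := hy
    have hz : area d (z - v e) = 0 := hz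
    show area d (a • y + b • z - v e) = 0
    simp only [area, Complex.sub_re, Complex.sub_im, Complex.add_re, Complex.add_im,
      Complex.smul_re, Complex.smul_im, smul_eq_mul] at hy hz ⊢
    have : b = 1 - a := by linarith
    subst this
    linear_combination a * hy + (1 - a) * hz
  have hsub : convexHull ℝ (Set.range v) ⊆ {z | area d (z - v e) = 0} :=
    convexHull_min (by rintro _ ⟨i, rfl⟩; exact hall i) hconv
  obtain ⟨z, hz⟩ := hne
  have hcont : Filter.Tendsto (fun t : ℝ => z + t • (Complex.I * d)) (nhdsWithin 0 (Set.Ioi 0))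
      (nhds z) := by
    have : Continuous fun t : ℝ => z + t • (Complex.I * d) := by fun_prop
    simpa using (this.tendsto 0).mono_left nhdsWithin_le_nhds
  obtain ⟨t, ht, ht0⟩ := ((hcont.eventually (mem_interior_iff_mem_nhds.1 hz)).and
    self_mem_nhdsWithin).exists
  have h1 : area d (z - v e) = 0 := hsub (interior_subset hz)
  have h2 : area d (z + t • (Complex.I * d) - v e) = 0 := hsub ht
  have ht0 : 0 < t := ht0
  simp only [area, Complex.sub_re, Complex.sub_im, Complex.add_re, Complex.add_im,
    Complex.smul_re, Complex.smul_im, smul_eq_mul, Complex.mul_re, Complex.mul_im, Complex.I_re,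
    Complex.I_im] at h1 h2
  have h3 : t * (d.re * d.re + d.im * d.im) = 0 := by linear_combination h2 - h1
  have h4 := (mul_eq_zero.1 h3).resolve_left ht0.ne'
  apply hd0
  apply Complex.ext
  · simp only [Complex.zero_re]; nlinarith [mul_self_nonneg d.re, mul_self_nonneg d.im]
  · simp only [Complex.zero_im]; nlinarith [mul_self_nonneg d.re, mul_self_nonneg d.im]

/-- If a connected part of a triangle outside a convex set touches two corners outside this set,
then the convex set does not meet both the side between the corners and another side. -/
lemma disjoint_sides_of_isPreconnected {v : Fin 3 → ℂ} (hv : IsTriangle v)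
    (hne : (interior (convexHull ℝ (Set.range v))).Nonempty) {L R : Set ℂ} (hL : Convex ℝ L)
    (hR : IsPreconnected R) (hRv : R ⊆ interior (convexHull ℝ (Set.range v))) (hRL : Disjoint R L)
    {e : Fin 3} (he : v e ∈ closure R) (he' : v (e + 1) ∈ closure R) (heL : v e ∉ L)
    (heL' : v (e + 1) ∉ L) :
    (∀ z ∈ segment ℝ (v e) (v (e + 1)), z ∉ L) ∨
    (∀ z ∈ segment ℝ (v (e + 1)) (v (e + 2)) ∪ segment ℝ (v (e + 2)) (v e), z ∉ L) := by
  by_contra! h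
  obtain ⟨⟨q, hq, hqL⟩, q', hq', hqL'⟩ := h
  have harea := area_ne_zero_of_interior_nonempty hv hne e
  have hqf := hv.segment_subset_frontier e hq
  have hqf' : q' ∈ frontier (convexHull ℝ (Set.range v)) := by
    rcases hq' with h | h
    · have := hv.segment_subset_frontier (e + 1)
      rw [show e + 1 + 1 = e + 2 by rw [add_assoc]; rfl] at this
      exact this h
    · have := hv.segment_subset_frontier (e + 2)
      rw [show e + 2 + 1 = e by rw [add_assoc]; exact add_zero e] at this
      exact this h
  obtain ⟨s, t, hs, ht, hst, hq⟩ := hq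
  -- Barycentric coordinates of `q'`. If the weight `w` of the third corner vanished, `q'` would be
  -- one of the two corners outside `L`.
  obtain ⟨x, y, w, hw0, hxyw, hq'⟩ : ∃ x y w : ℝ, w ≠ 0 ∧ x + y + w = 1 ∧
      q' = x • v e + y • v (e + 1) + w • v (e + 2) := by
    rcases hq' with ⟨a, b, ha, hb, hab, rfl⟩ | ⟨a, b, ha, hb, hab, rfl⟩
    · refine ⟨0, a, b, ?_, by linarith, by simp⟩
      rintro rfl
      apply heL'
      simpa [show a = 1 by linarith] using hqL'
    · refine ⟨b, 0, a, ?_, by linarith, by simp [add_comm]⟩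
      rintro rfl
      apply heL
      simpa [show b = 1 by linarith] using hqL'
  have hs0 : 0 < s := lt_of_le_of_ne hs fun h0 => heL' (by
    subst h0
    simpa [hq.symm, show t = 1 by linarith] using hqL)
  have ht0 : 0 < t := lt_of_le_of_ne ht fun h0 => heL (by
    subst h0
    simpa [hq.symm, show s = 1 by linarith] using hqL)
  have hx : x = 1 - y - w := by linarith
  have hs1 : s = 1 - t := by linarith
  -- This area and the next have opposite signs: the line through `q` and `q'` separates the two
  -- corners, so the connected set `R` must cross it. It does so inside the triangle, hence on the
  -- chord, which lies in `L`.
  have e1 : area (q' - q) (v e - q) =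
      t * w * area (v (e + 1) - v e) (v (e + 2) - v e) := by
    rw [hq', ← hq, hx, hs1]
    simp only [area, Complex.sub_re, Complex.sub_im, Complex.add_re, Complex.add_im,
      Complex.smul_re, Complex.smul_im, smul_eq_mul]
    ring
  have e2 : area (q' - q) (v (e + 1) - q) =
      -(s * w * area (v (e + 1) - v e) (v (e + 2) - v e)) := by
    rw [hq', ← hq, hx, hs1]
    simp only [area, Complex.sub_re, Complex.sub_im, Complex.add_re, Complex.add_im,
      Complex.smul_re, Complex.smul_im, smul_eq_mul]
    ring
  have hcont := continuous_area_sub (q' - q) q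
  have hqq : q ≠ q' := by
    rintro rfl
    have : area (q - q) (v e - q) = 0 := by simp [area]
    rw [this] at e1
    exact mul_ne_zero (mul_ne_zero ht0.ne' hw0) harea e1.symm
  obtain ⟨z, hzR, hz⟩ : ∃ z ∈ R, area (q' - q) (z - q) = 0 := by
    have key {a b : ℂ} (ha : a ∈ closure R) (hb : b ∈ closure R) (h1 : area (q' - q) (a - q) < 0)
        (h2 : 0 < area (q' - q) (b - q)) : ∃ z ∈ R, area (q' - q) (z - q) = 0 := by
      obtain ⟨a', ha', haR⟩ := mem_closure_iff.1 ha _ (isOpen_lt hcont continuous_const) h1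
      obtain ⟨b', hb', hbR⟩ := mem_closure_iff.1 hb _ (isOpen_lt continuous_const hcont) h2
      obtain ⟨z, hz, hz'⟩ := hR.intermediate_value haR hbR hcont.continuousOn
        ⟨le_of_lt ha', le_of_lt hb'⟩
      exact ⟨z, hz, hz'⟩
    rcases lt_or_gt_of_ne (mul_ne_zero hw0 harea) with h | h
    · refine key he he' ?_ ?_
      · rw [e1, mul_assoc]; exact mul_neg_of_pos_of_neg ht0 h
      · rw [e2, mul_assoc]; have := mul_neg_of_pos_of_neg hs0 h; linarith
    · refine key he' he ?_ ?_
      · rw [e2, mul_assoc]; have := mul_pos hs0 h; linarith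
      · rw [e1, mul_assoc]; exact mul_pos ht0 h
  have hzseg := mem_segment_of_area_eq_zero (convex_convexHull ℝ _) (isClosed_triangle v) hqf hqf'
    hqq (hRv hzR) hz
  exact hRL.le_bot ⟨hzR, hL.segment_subset hqL hqL' hzseg⟩

/-- In both cases some side misses the other triangle altogether, and the remaining two sides
contribute at most two points each. -/
lemma IsTriangle.ncard_inter_le_four {v w : Fin 3 → ℂ} (hv : IsTriangle v)
    (hfin : (frontier (convexHull ℝ (Set.range v)) ∩
      frontier (convexHull ℝ (Set.range w))).Finite) {e : Fin 3}
    (h : (∀ z ∈ segment ℝ (v e) (v (e + 1)), z ∉ convexHull ℝ (Set.range w)) ∨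
      (∀ z ∈ segment ℝ (v (e + 1)) (v (e + 2)) ∪ segment ℝ (v (e + 2)) (v e),
        z ∉ convexHull ℝ (Set.range w))) :
    (frontier (convexHull ℝ (Set.range v)) ∩ frontier (convexHull ℝ (Set.range w))).ncard ≤ 4 := by
  have h0 {a : Fin 3} (h : ∀ z ∈ segment ℝ (v a) (v (a + 1)), z ∉ convexHull ℝ (Set.range w)) :
      (halfOpenSegment (v a) (v (a + 1)) ∩ frontier (convexHull ℝ (Set.range w))).ncard = 0 := by
    have : halfOpenSegment (v a) (v (a + 1)) ∩ frontier (convexHull ℝ (Set.range w)) = ∅ := by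
      rw [Set.eq_empty_iff_forall_notMem]
      rintro z ⟨hz, hz'⟩
      exact h z (halfOpenSegment_subset _ _ hz) ((isClosed_triangle w).frontier_subset hz')
    rw [this, Set.ncard_empty]
  have h1 := hv.ncard_inter_le_sum (frontier (convexHull ℝ (Set.range w)))
  have h2 := hv.ncard_side_le_two hfin
  obtain ⟨a, ha⟩ : ∃ a : Fin 3, ∀ z ∈ segment ℝ (v a) (v (a + 1)),
      z ∉ convexHull ℝ (Set.range w) := by
    rcases h with h | h
    · exact ⟨e, h⟩
    · refine ⟨e + 1, fun z hz => h z (Or.inl ?_)⟩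
      rwa [show e + 1 + 1 = e + 2 by rw [add_assoc]; rfl] at hz
  have h3 := h0 ha
  have h4 := h2 0
  have h5 := h2 1
  have h6 := h2 2
  rw [Fin.sum_univ_three] at h1
  fin_cases a <;> simp only [Fin.zero_eta, Fin.mk_one, Fin.reduceFinMk] at h3 <;> omega

end Chords

/-! ### Counting regions by their lowest points. -/

section Counting

/-- The set of the points interior to the triangles indexed by `S` and outside all the others. -/
def triangleRegion {n : ℕ} (v : Fin n → Fin 3 → ℂ) (S : Set (Fin n)) : Set ℂ :=
  {z | (∀ i ∈ S, z ∈ interior (convexHull ℝ (Set.range (v i)))) ∧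
    ∀ i ∉ S, z ∉ convexHull ℝ (Set.range (v i))}

/-- The inverse slope of the line through `p` and `q`, after multiplication by `u`. -/
noncomputable def slopeAt (u p q : ℂ) : ℝ := (u * (q - p)).re / (u * (q - p)).im

open scoped Classical in
/-- The inverse slopes of the sides of a triangle that go upwards from `p`. -/
noncomputable def upSlopes (u : ℂ) (w : Fin 3 → ℂ) (p : ℂ) : Finset ℝ :=
  (Finset.univ.filter fun e : Fin 3 => p ∈ segment ℝ (w e) (w (e + 1)) ∧
    ∃ q ∈ segment ℝ (w e) (w (e + 1)), (u * p).im < (u * q).im).image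
      fun e => slopeAt u (w e) (w (e + 1))

/-- The point `p` is the lowest corner of a triangle. -/
def IsBottom (u : ℂ) (w : Fin 3 → ℂ) (p : ℂ) : Prop :=
  ∃ a, p = w a ∧ ∀ e, e ≠ a → (u * w a).im < (u * w e).im

variable {u : ℂ}

lemma im_mul_combo (s t : ℝ) (a b : ℂ) :
    (u * (s • a + t • b)).im = s * (u * a).im + t * (u * b).im := by
  simp only [Complex.mul_im, Complex.add_re, Complex.add_im, Complex.smul_re, Complex.smul_im,
    smul_eq_mul]
  ring

lemma re_mul_combo (s t : ℝ) (a b : ℂ) :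
    (u * (s • a + t • b)).re = s * (u * a).re + t * (u * b).re := by
  simp only [Complex.mul_re, Complex.add_re, Complex.add_im, Complex.smul_re, Complex.smul_im,
    smul_eq_mul]
  ring

lemma exists_sub_eq_smul {a b p q : ℂ} (hp : p ∈ segment ℝ a b) (hq : q ∈ segment ℝ a b) :
    ∃ t : ℝ, q - p = t • (b - a) := by
  obtain ⟨s, t, -, -, hst, rfl⟩ := hp
  obtain ⟨s', t', -, -, hst', rfl⟩ := hq
  refine ⟨t' - t, ?_⟩
  have h1 : s = 1 - t := by linarith
  have h2 : s' = 1 - t' := by linarith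
  rw [h1, h2]
  module

lemma slopeAt_eq_of_mem_segment {a b p q : ℂ} (hp : p ∈ segment ℝ a b) (hq : q ∈ segment ℝ a b)
    (hne : p ≠ q) : slopeAt u p q = slopeAt u a b := by
  obtain ⟨t, ht⟩ := exists_sub_eq_smul hp hq
  have ht0 : t ≠ 0 := by
    rintro rfl
    rw [zero_smul, sub_eq_zero] at ht
    exact hne ht.symm
  have h1 : (u * (t • (b - a))).im = t * (u * (b - a)).im := by
    simpa using im_mul_combo (u := u) t 0 (b - a) 0
  have h2 : (u * (t • (b - a))).re = t * (u * (b - a)).re := by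
    simpa using re_mul_combo (u := u) t 0 (b - a) 0
  rw [slopeAt, ht, h1, h2, mul_div_mul_left _ _ ht0, slopeAt]

lemma im_ne_of_mem_segment {a b p q : ℂ} (hab : (u * a).im ≠ (u * b).im)
    (hp : p ∈ segment ℝ a b) (hq : q ∈ segment ℝ a b) (hne : p ≠ q) :
    (u * p).im ≠ (u * q).im := by
  obtain ⟨t, ht⟩ := exists_sub_eq_smul hp hq
  intro h
  have h1 : (u * (q - p)).im = 0 := by rw [mul_sub, Complex.sub_im, h, sub_self]
  have h2 : (u * (t • (b - a))).im = t * (u * (b - a)).im := by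
    simpa using im_mul_combo (u := u) t 0 (b - a) 0
  rw [ht, h2, mul_sub, Complex.sub_im] at h1
  rcases mul_eq_zero.1 h1 with h0 | h0
  · rw [h0, zero_smul, sub_eq_zero] at ht
    exact hne ht.symm
  · exact hab (sub_eq_zero.1 h0).symm

lemma lt_of_mem_segment_of_lt {a b q : ℂ} (hq : q ∈ segment ℝ a b)
    (h : (u * a).im < (u * q).im) : (u * a).im < (u * b).im := by
  obtain ⟨s, t, hs, ht, hst, rfl⟩ := hq
  rw [im_mul_combo] at h
  by_contra! h'
  have := mul_le_mul_of_nonneg_left h' ht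
  have hs' : s = 1 - t := by linarith
  subst hs'
  linarith

/-- If `p` were the common corner, both other corners would be higher and `p` the bottom. Otherwise
both slopes are that of the line from `p` to the common corner. -/
lemma slopeAt_eq_of_adjacent {w : Fin 3 → ℂ} {p : ℂ} (hbot : ¬ IsBottom u w p) {e : Fin 3}
    (h : p ∈ segment ℝ (w e) (w (e + 1)) ∧
      ∃ q ∈ segment ℝ (w e) (w (e + 1)), (u * p).im < (u * q).im)
    (h' : p ∈ segment ℝ (w (e + 1)) (w (e + 1 + 1)) ∧
      ∃ q ∈ segment ℝ (w (e + 1)) (w (e + 1 + 1)), (u * p).im < (u * q).im) :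
    slopeAt u (w e) (w (e + 1)) = slopeAt u (w (e + 1)) (w (e + 1 + 1)) := by
  obtain ⟨hp, q, hq, hpq⟩ := h
  obtain ⟨hp', q', hq', hpq'⟩ := h'
  rcases eq_or_ne p (w (e + 1)) with rfl | hne
  · refine absurd ⟨e + 1, rfl, fun i hi => ?_⟩ hbot
    obtain rfl | rfl : i = e ∨ i = e + 1 + 1 := by
      revert hi
      fin_cases e <;> fin_cases i <;> decide
    · rw [segment_symm] at hq
      exact lt_of_mem_segment_of_lt hq hpq
    · exact lt_of_mem_segment_of_lt hq' hpq'
  · rw [← slopeAt_eq_of_mem_segment hp (right_mem_segment ℝ _ _) hne,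
      ← slopeAt_eq_of_mem_segment hp' (left_mem_segment ℝ _ _) hne]

open scoped Classical in
-- The side opposite the bottom corner lies strictly above it, leaving two sides. At any other point
-- all rising sides share one slope, since any two sides of a triangle are adjacent.
lemma card_upSlopes_le {w : Fin 3 → ℂ} (hw : IsTriangle w) (p : ℂ) :
    (upSlopes u w p).card ≤ (if p ∈ frontier (convexHull ℝ (Set.range w)) then 1 else 0) +
      (if IsBottom u w p then 1 else 0) := by
  by_cases hpf : p ∈ frontier (convexHull ℝ (Set.range w))
  swap
  · have : upSlopes u w p = ∅ := by
      rw [upSlopes, Finset.image_eq_empty, Finset.filter_eq_empty_iff]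
      exact fun e _ h => hpf (hw.segment_subset_frontier e h.1)
    simp [this]
  rw [if_pos hpf]
  split_ifs with hbot
  · obtain ⟨a, rfl, ha⟩ := hbot
    refine Finset.card_image_le.trans (le_trans (Finset.card_le_card
      (t := Finset.univ.erase (a + 1)) fun e he => ?_) (by simp))
    refine Finset.mem_erase.2 ⟨?_, Finset.mem_univ _⟩
    rintro rfl
    obtain ⟨⟨s, t, hs, ht, hst, h⟩, -⟩ := (Finset.mem_filter.1 he).2
    have h1 := ha (a + 1) (by fin_cases a <;> decide)
    have h2 := ha (a + 1 + 1) (by fin_cases a <;> decide)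
    have h3 := im_mul_combo (u := u) s t (w (a + 1)) (w (a + 1 + 1))
    rw [h] at h3
    have hs' : s = 1 - t := by linarith
    subst hs'
    rcases ht.eq_or_lt with rfl | ht
    · linarith
    · have := mul_lt_mul_of_pos_left h2 ht
      have := mul_le_mul_of_nonneg_left h1.le hs
      linarith
  · refine Finset.card_le_one.2 fun x hx y hy => ?_
    obtain ⟨e, he, rfl⟩ := Finset.mem_image.1 hx
    obtain ⟨e', he', rfl⟩ := Finset.mem_image.1 hy
    have he := (Finset.mem_filter.1 he).2
    have he' := (Finset.mem_filter.1 he').2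
    obtain rfl | rfl | rfl : e = e' ∨ e' = e + 1 ∨ e = e' + 1 := by
      fin_cases e <;> fin_cases e' <;> decide
    · rfl
    · exact slopeAt_eq_of_adjacent hbot he he'
    · exact (slopeAt_eq_of_adjacent hbot he' he).symm

variable {n : ℕ} {v : Fin n → Fin 3 → ℂ}

lemma isOpen_triangleRegion (v : Fin n → Fin 3 → ℂ) (S : Set (Fin n)) :
    IsOpen (triangleRegion v S) := by
  have : triangleRegion v S = (⋂ i ∈ S, interior (convexHull ℝ (Set.range (v i)))) ∩
      ⋂ i ∈ Sᶜ, (convexHull ℝ (Set.range (v i)))ᶜ := by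
    ext z
    simp [triangleRegion]
  rw [this]
  exact (S.toFinite.isOpen_biInter fun _ _ => isOpen_interior).inter
    (Sᶜ.toFinite.isOpen_biInter fun i _ => (isClosed_triangle (v i)).isOpen_compl)

lemma eq_of_mem_triangleRegion {S S' : Set (Fin n)} {z : ℂ} (h : z ∈ triangleRegion v S)
    (h' : z ∈ triangleRegion v S') : S = S' := by
  ext i
  constructor
  · intro hi
    by_contra hi'
    exact h'.2 i hi' (interior_subset (h.1 i hi))
  · intro hi
    by_contra hi'
    exact h.2 i hi' (interior_subset (h'.1 i hi))

/-- A connected set cannot pass from the interior of a triangle to its complement without meeting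
the frontier. -/
lemma mem_triangleRegion_of_segment {S : Set (Fin n)} {y z : ℂ} (hy : y ∈ triangleRegion v S)
    (h : ∀ x ∈ segment ℝ y z, ∀ i, x ∉ frontier (convexHull ℝ (Set.range (v i)))) :
    z ∈ triangleRegion v S := by
  have hsub (i : Fin n) : segment ℝ y z ⊆
      interior (convexHull ℝ (Set.range (v i))) ∪ (convexHull ℝ (Set.range (v i)))ᶜ := by
    rw [← compl_frontier_eq (isClosed_triangle (v i))]
    exact fun x hx => h x hx i
  have hdisj (i : Fin n) : Disjoint (interior (convexHull ℝ (Set.range (v i))))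
      (convexHull ℝ (Set.range (v i)))ᶜ := disjoint_compl_right.mono_left interior_subset
  have hconn := (convex_segment (𝕜 := ℝ) y z).isPreconnected
  constructor
  · intro i hi
    exact hconn.subset_left_of_subset_union isOpen_interior (isClosed_triangle (v i)).isOpen_compl
      (hdisj i) (hsub i) ⟨y, left_mem_segment ℝ y z, hy.1 i hi⟩ (right_mem_segment ℝ y z)
  · intro i hi
    exact hconn.subset_right_of_subset_union isOpen_interior (isClosed_triangle (v i)).isOpen_compl
      (hdisj i) (hsub i) ⟨y, left_mem_segment ℝ y z, hy.2 i hi⟩ (right_mem_segment ℝ y z)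

/-- No side is horizontal after multiplication by `u`. -/
def NoHorizontalSide (u : ℂ) (v : Fin n → Fin 3 → ℂ) : Prop :=
  ∀ i e, (u * v i e).im ≠ (u * v i (e + 1)).im

lemma exists_noHorizontalSide (hv : ∀ i, IsTriangle (v i)) : ∃ u, NoHorizontalSide u v := by
  have hfin : (⋃ (i : Fin n) (e : Fin 3), {t : ℝ | ((1 + t * Complex.I) * v i e).im =
      ((1 + t * Complex.I) * v i (e + 1)).im}).Finite := by
    refine Set.finite_iUnion fun i => Set.finite_iUnion fun e => Set.Subsingleton.finite ?_
    intro s hs t ht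
    simp only [Set.mem_ofPred_eq, Complex.mul_im, Complex.add_re, Complex.one_re,
      Complex.ofReal_re, Complex.I_re, mul_zero, Complex.ofReal_im, Complex.I_im, mul_one,
      sub_self, add_zero, one_mul, Complex.add_im, Complex.one_im, zero_add, Complex.mul_re]
      at hs ht
    by_contra hst
    have hre : (v i e).re = (v i (e + 1)).re := by
      have : (s - t) * ((v i e).re - (v i (e + 1)).re) = 0 := by linear_combination hs - ht
      exact sub_eq_zero.1 ((mul_eq_zero.1 this).resolve_left (sub_ne_zero.2 hst))
    refine (hv i).ne_add_one e (Complex.ext hre ?_)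
    rw [hre] at hs
    linarith
  obtain ⟨t, ht⟩ := hfin.infinite_compl.nonempty
  refine ⟨1 + t * Complex.I, fun i e h => ht ?_⟩
  exact Set.mem_iUnion.2 ⟨i, Set.mem_iUnion.2 ⟨e, h⟩⟩

lemma NoHorizontalSide.ne_zero (hu : NoHorizontalSide u v) (i : Fin n) : u ≠ 0 := by
  rintro rfl
  exact hu i 0 (by simp)

/-- The inverse slopes of all the sides that go upwards from `p`. -/
noncomputable def allUpSlopes (u : ℂ) (v : Fin n → Fin 3 → ℂ) (p : ℂ) : Finset ℝ :=
  Finset.univ.biUnion fun i => upSlopes u (v i) p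

/-- The sides that meet the ball contain its centre. -/
def IsLocalRadius (v : Fin n → Fin 3 → ℂ) (p : ℂ) (r : ℝ) : Prop :=
  0 < r ∧ ∀ q ∈ Metric.ball p r, ∀ i e, q ∈ segment ℝ (v i e) (v i (e + 1)) →
    p ∈ segment ℝ (v i e) (v i (e + 1))

lemma exists_isLocalRadius (v : Fin n → Fin 3 → ℂ) (p : ℂ) : ∃ r, IsLocalRadius v p r := by
  have h : ∀ᶠ q in nhds p, ∀ i e, q ∈ segment ℝ (v i e) (v i (e + 1)) →
      p ∈ segment ℝ (v i e) (v i (e + 1)) := by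
    refine Filter.eventually_all.2 fun i => Filter.eventually_all.2 fun e => ?_
    by_cases hp : p ∈ segment ℝ (v i e) (v i (e + 1))
    · exact Filter.Eventually.of_forall fun _ _ => hp
    · have hc : IsClosed (segment ℝ (v i e) (v i (e + 1))) := by
        rw [← convexHull_pair]
        exact ((Set.toFinite _).isCompact_convexHull ℝ).isClosed
      filter_upwards [hc.isOpen_compl.mem_nhds hp] with q hq hq'
      exact absurd hq' hq
  obtain ⟨r, hr, h⟩ := Metric.eventually_nhds_iff_ball.1 h
  exact ⟨r, hr, h⟩

open scoped Classical in
lemma slopeAt_mem_allUpSlopes (hv : ∀ i, IsTriangle (v i)) {p y : ℂ} {r : ℝ}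
    (hr : IsLocalRadius v p r) (hy : y ∈ Metric.ball p r) (hpy : (u * p).im < (u * y).im)
    {i : Fin n} (hyi : y ∈ frontier (convexHull ℝ (Set.range (v i)))) :
    slopeAt u p y ∈ allUpSlopes u v p := by
  rw [(hv i).frontier_eq] at hyi
  obtain ⟨e, he⟩ := Set.mem_iUnion.1 hyi
  have hp := hr.2 y hy i e he
  rw [slopeAt_eq_of_mem_segment hp he (by rintro rfl; exact lt_irrefl _ hpy)]
  exact Finset.mem_biUnion.2 ⟨i, Finset.mem_univ _, Finset.mem_image.2 ⟨e, Finset.mem_filter.2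
    ⟨Finset.mem_univ _, hp, y, he, hpy⟩, rfl⟩⟩

lemma im_mul_sub_pos {p z : ℂ} (h : (u * p).im < (u * z).im) : 0 < (u * (z - p)).im := by
  rw [mul_sub, Complex.sub_im]
  exact sub_pos.2 h

/-- Adding a real multiple of the conjugate of `u` is a horizontal move in the coordinates given by
`u`. -/
lemma mul_conj_smul_im (x : ℝ) : (u * (x • (starRingEnd ℂ) u)).im = 0 := by
  simp [Complex.mul_im]; ring

lemma mul_conj_smul_re (x : ℝ) : (u * (x • (starRingEnd ℂ) u)).re = x * Complex.normSq u := by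
  simp [Complex.mul_re, Complex.normSq_apply]; ring

/-- Sliding a point of the open region horizontally changes its slope injectively, and only finitely
many slopes are forbidden. -/
lemma exists_notMem_allUpSlopes (hu : u ≠ 0) {S : Set (Fin n)} {p : ℂ}
    (hp : p ∈ closure (triangleRegion v S))
    (hmin : ∀ z ∈ triangleRegion v S, (u * p).im < (u * z).im) {r : ℝ} (hr : 0 < r) :
    ∃ z ∈ triangleRegion v S, z ∈ Metric.ball p r ∧ slopeAt u p z ∉ allUpSlopes u v p := by
  obtain ⟨z, hzb, hzS⟩ := mem_closure_iff.1 hp _ Metric.isOpen_ball (Metric.mem_ball_self hr)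
  have hT := im_mul_sub_pos (hmin z hzS)
  set f : ℝ → ℂ := fun x => z + x • (starRingEnd ℂ) u with hf
  have hcont : Continuous f := by fun_prop
  have hN : f ⁻¹' (Metric.ball p r ∩ triangleRegion v S) ∈ nhds 0 :=
    hcont.continuousAt.preimage_mem_nhds
      ((Metric.isOpen_ball.inter (isOpen_triangleRegion v S)).mem_nhds
        (by simpa [hf] using ⟨hzb, hzS⟩))
  have hslope (x : ℝ) : slopeAt u p (f x) =
      ((u * (z - p)).re + x * Complex.normSq u) / (u * (z - p)).im := by
    rw [slopeAt, hf]
    simp only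
    rw [show z + x • (starRingEnd ℂ) u - p = (z - p) + x • (starRingEnd ℂ) u by ring, mul_add,
      Complex.add_re, Complex.add_im, mul_conj_smul_im, mul_conj_smul_re, add_zero]
  have hinj : Function.Injective fun x => slopeAt u p (f x) := by
    intro x y hxy
    simp only [hslope] at hxy
    have := (div_left_inj' hT.ne').1 hxy
    exact mul_right_cancel₀ (Complex.normSq_pos.2 hu).ne' (add_left_cancel this)
  have hbad : ((fun x => slopeAt u p (f x)) ⁻¹' (allUpSlopes u v p : Set ℝ)).Finite :=
    (allUpSlopes u v p).finite_toSet.preimage hinj.injOn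
  obtain ⟨x, hx, hx'⟩ := ((infinite_of_mem_nhds 0 hN).sdiff hbad).nonempty
  exact ⟨f x, hx.2, hx.1, hx'⟩

/-- At a lowest point of a region there is a side on either side of the region. -/
lemma exists_mem_allUpSlopes (hv : ∀ i, IsTriangle (v i)) (hu : NoHorizontalSide u v) (hu0 : u ≠ 0)
    {S : Set (Fin n)} {p : ℂ} (hmin : ∀ z ∈ triangleRegion v S, (u * p).im < (u * z).im) {r : ℝ}
    (hr : IsLocalRadius v p r) {z : ℂ} (hzS : z ∈ triangleRegion v S) (hz : z ∈ Metric.ball p r)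
    (hzE : slopeAt u p z ∉ allUpSlopes u v p) {x : ℝ} (hx : x ≠ 0) :
    ∃ s ∈ allUpSlopes u v p, 0 < (s - slopeAt u p z) * x := by
  by_contra! hno
  have hT := im_mul_sub_pos (hmin z hzS)
  have hn := Complex.normSq_pos.2 hu0
  obtain ⟨δ, hδ, hδb⟩ : ∃ δ : ℝ, 0 < δ ∧ p + (δ * x) • (starRingEnd ℂ) u ∈ Metric.ball p r := by
    have hcont : Filter.Tendsto (fun δ : ℝ => p + (δ * x) • (starRingEnd ℂ) u)
        (nhdsWithin 0 (Set.Ioi 0)) (nhds p) := by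
      have : Continuous fun δ : ℝ => p + (δ * x) • (starRingEnd ℂ) u := by fun_prop
      simpa using (this.tendsto 0).mono_left nhdsWithin_le_nhds
    obtain ⟨δ, h1, h2⟩ := ((hcont.eventually (Metric.ball_mem_nhds p hr.1)).and
      self_mem_nhdsWithin).exists
    exact ⟨δ, h2, h1⟩
  set q := p + (δ * x) • (starRingEnd ℂ) u with hq
  have hqp : (u * q).im = (u * p).im := by
    rw [hq, mul_add, Complex.add_im, mul_conj_smul_im, add_zero]
  -- With no side to be crossed on this side of `z`, the region would extend down to `q`, which is
  -- at the height of `p`, against minimality.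
  have hqS : q ∈ triangleRegion v S := by
    refine mem_triangleRegion_of_segment hzS fun y hy i hyi => ?_
    have hyb := (convex_ball p r).segment_subset hz hδb hy
    obtain ⟨a, t, ha, ht, hat, rfl⟩ := hy
    rcases ha.eq_or_lt with rfl | ha
    -- A side through `q` itself would also contain `p`, hence be horizontal.
    · have ht1 : t = 1 := by linarith
      rw [zero_smul, zero_add, ht1, one_smul] at hyi hyb
      rw [(hv i).frontier_eq] at hyi
      obtain ⟨e, he⟩ := Set.mem_iUnion.1 hyi
      refine im_ne_of_mem_segment (hu i e) he (hr.2 q hyb i e he) ?_ hqp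
      intro h
      rw [hq, add_eq_left, smul_eq_zero] at h
      rcases h with h | h
      · exact (mul_ne_zero hδ.ne' hx) h
      · exact hu0 (by simpa using h)
    · have h1 : (u * (a • z + t • q)).im = (u * p).im + a * (u * (z - p)).im := by
        rw [im_mul_combo, hqp, mul_sub, Complex.sub_im]
        linear_combination (u * p).im * hat
      have hpos := mul_pos ha hT
      have hmem := slopeAt_mem_allUpSlopes (u := u) hv hr hyb (by rw [h1]; linarith) hyi
      have hsl : slopeAt u p (a • z + t • q) =
          slopeAt u p z + t * (δ * x * Complex.normSq u) / (a * (u * (z - p)).im) := by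
        have e1 : a • z + t • q - p = a • (z - p) + t • ((δ * x) • (starRingEnd ℂ) u) := by
          have : a = 1 - t := by linarith
          rw [hq, this]
          module
        rw [slopeAt, e1, re_mul_combo, im_mul_combo, mul_conj_smul_im, mul_conj_smul_re, mul_zero,
          add_zero, slopeAt]
        field_simp
      have h2 := hno _ hmem
      have h3 : (slopeAt u p (a • z + t • q) - slopeAt u p z) * x =
          t * δ * Complex.normSq u * (x * x) / (a * (u * (z - p)).im) := by
        rw [hsl]
        ring
      have h4 : 0 ≤ t * δ * Complex.normSq u * (x * x) / (a * (u * (z - p)).im) := by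
        have := mul_self_nonneg x
        positivity
      have h5 : (slopeAt u p (a • z + t • q) - slopeAt u p z) * x = 0 :=
        le_antisymm h2 (h3 ▸ h4)
      have h6 := sub_eq_zero.1 ((mul_eq_zero.1 h5).resolve_right hx)
      exact hzE (h6 ▸ hmem)
  exact (hmin q hqS).ne' hqp

/-- Two regions that touch `p` in the same wedge are equal. -/
lemma eq_of_same_wedge (hv : ∀ i, IsTriangle (v i)) {S S' : Set (Fin n)} {p : ℂ} {r : ℝ}
    (hr : IsLocalRadius v p r) {z z' : ℂ} (hz : z ∈ triangleRegion v S)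
    (hz' : z' ∈ triangleRegion v S') (hzb : z ∈ Metric.ball p r) (hzb' : z' ∈ Metric.ball p r)
    (hpz : (u * p).im < (u * z).im) (hpz' : (u * p).im < (u * z').im)
    (hle : slopeAt u p z ≤ slopeAt u p z')
    (hE : ∀ s ∈ allUpSlopes u v p, ¬ (slopeAt u p z ≤ s ∧ s ≤ slopeAt u p z')) : S = S' := by
  refine eq_of_mem_triangleRegion (mem_triangleRegion_of_segment hz fun y hy i hyi => ?_) hz'
  have hyb := (convex_ball p r).segment_subset hzb hzb' hy
  have hT := im_mul_sub_pos hpz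
  have hT' := im_mul_sub_pos hpz'
  obtain ⟨a, t, ha, ht, hat, rfl⟩ := hy
  have e1 : a • z + t • z' - p = a • (z - p) + t • (z' - p) := by
    have : a = 1 - t := by linarith
    rw [this]
    module
  have hpos : 0 < a * (u * (z - p)).im + t * (u * (z' - p)).im := by
    rcases ha.eq_or_lt with rfl | ha
    · have : t = 1 := by linarith
      subst this
      linarith
    · have := mul_pos ha hT
      have := mul_nonneg ht hT'.le
      linarith
  have hpy : (u * p).im < (u * (a • z + t • z')).im := by
    have h : (u * (a • z + t • z' - p)).im = a * (u * (z - p)).im + t * (u * (z' - p)).im := by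
      rw [e1, im_mul_combo]
    rw [mul_sub, Complex.sub_im] at h
    linarith
  refine hE _ (slopeAt_mem_allUpSlopes hv hr hyb hpy hyi) ?_
  have h1 : slopeAt u p z * (u * (z - p)).im = (u * (z - p)).re := div_mul_cancel₀ _ hT.ne'
  have h2 : slopeAt u p z' * (u * (z' - p)).im = (u * (z' - p)).re := div_mul_cancel₀ _ hT'.ne'
  have h3 := mul_le_mul_of_nonneg_right hle hT.le
  have h4 := mul_le_mul_of_nonneg_right hle hT'.le
  have hy : slopeAt u p (a • z + t • z') = (a * (u * (z - p)).re + t * (u * (z' - p)).re) /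
      (a * (u * (z - p)).im + t * (u * (z' - p)).im) := by
    rw [slopeAt, e1, re_mul_combo, im_mul_combo]
  rw [hy, le_div_iff₀ hpos, div_le_iff₀ hpos, ← h1, ← h2]
  have h5 := mul_le_mul_of_nonneg_left h3 ha
  have h6 := mul_le_mul_of_nonneg_left h4 ht
  constructor <;> linarith

/-- The number of regions with the lowest point `p`. -/
lemma card_le_card_allUpSlopes (hv : ∀ i, IsTriangle (v i)) (hu : NoHorizontalSide u v)
    (hu0 : u ≠ 0) (p : ℂ) (F : Finset (Finset (Fin n)))
    (hcl : ∀ S ∈ F, p ∈ closure (triangleRegion v (S : Set (Fin n))))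
    (hmin : ∀ S ∈ F, ∀ z ∈ triangleRegion v (S : Set (Fin n)), (u * p).im < (u * z).im) :
    F.card ≤ (allUpSlopes u v p).card - 1 := by
  classical
  obtain ⟨r, hr⟩ := exists_isLocalRadius v p
  choose! z hzS hzb hzE using fun S hS => exists_notMem_allUpSlopes hu0 (hcl S hS) (hmin S hS) hr.1
  rcases F.eq_empty_or_nonempty with rfl | ⟨S₀, hS₀⟩
  · simp
  have hex (S) (hS : S ∈ F) {x : ℝ} (hx : x ≠ 0) :=
    exists_mem_allUpSlopes hv hu hu0 (hmin S hS) hr (hzS S hS) (hzb S hS) (hzE S hS) hx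
  have habove (S) (hS : S ∈ F) :
      ((allUpSlopes u v p).filter fun s => slopeAt u p (z S) < s).Nonempty := by
    obtain ⟨s, hs, h⟩ := hex S hS one_ne_zero
    exact ⟨s, Finset.mem_filter.2 ⟨hs, by linarith⟩⟩
  -- Each region goes to the first slope above that of its sample point. Equal images mean the same
  -- wedge, hence the same region; the least slope is never taken, since every sample has a slope
  -- below it.
  choose! g hgmem hgle using fun S hS => Finset.exists_min_image _ id (habove S hS)
  simp only [Finset.mem_filter, id] at hgmem hgle
  have hE : (allUpSlopes u v p).Nonempty := ⟨_, (hgmem S₀ hS₀).1⟩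
  rw [← Finset.card_erase_of_mem ((allUpSlopes u v p).min'_mem hE)]
  refine Finset.card_le_card_of_injOn g (fun S hS => ?_) ?_
  · refine Finset.mem_coe.2 (Finset.mem_erase.2 ⟨?_, (hgmem S hS).1⟩)
    obtain ⟨s, hs, h⟩ := hex S hS (neg_ne_zero.2 one_ne_zero)
    have h1 := Finset.min'_le _ s hs
    have h2 := (hgmem S hS).2
    intro h3
    linarith
  · have key {S S'} (hS : S ∈ F) (hS' : S' ∈ F) (h : g S = g S')
        (hle : slopeAt u p (z S) ≤ slopeAt u p (z S')) : S = S' := by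
      refine Finset.coe_injective (eq_of_same_wedge hv hr (hzS S hS) (hzS S' hS') (hzb S hS)
        (hzb S' hS') (hmin S hS _ (hzS S hS)) (hmin S' hS' _ (hzS S' hS')) hle ?_)
      rintro s hs ⟨h1, h2⟩
      have h3 : slopeAt u p (z S) < s := lt_of_le_of_ne h1 fun h => hzE S hS (h ▸ hs)
      have h4 := hgle S hS s ⟨hs, h3⟩
      have h5 := (hgmem S' hS').2
      linarith
    intro S hS S' hS' h
    rcases le_total (slopeAt u p (z S)) (slopeAt u p (z S')) with hle | hle
    · exact key hS hS' h hle
    · exact (key hS' hS h.symm hle).symm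

/-- Nonemptiness of `S` makes the region bounded, so the height has a minimum on its closure. The
region is open, so the minimum is strictly below each of its points. -/
lemma exists_lowest_point (hu0 : u ≠ 0) {S : Set (Fin n)} (hS : S.Nonempty)
    (hne : (triangleRegion v S).Nonempty) : ∃ p ∈ closure (triangleRegion v S),
      ∀ z ∈ triangleRegion v S, (u * p).im < (u * z).im := by
  obtain ⟨i, hi⟩ := hS
  have hsub : closure (triangleRegion v S) ⊆ convexHull ℝ (Set.range (v i)) :=
    closure_minimal (fun z hz => interior_subset (hz.1 i hi)) (isClosed_triangle (v i))
  have hcomp : IsCompact (closure (triangleRegion v S)) :=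
    (isCompact_triangle (v i)).of_isClosed_subset isClosed_closure hsub
  obtain ⟨p, hp, hmin⟩ := hcomp.exists_isMinOn hne.closure
    (f := fun z => (u * z).im) (by fun_prop)
  refine ⟨p, hp, fun z hz => ?_⟩
  have hcont : Filter.Tendsto (fun t : ℝ => z - t • (Complex.I * (starRingEnd ℂ) u))
      (nhdsWithin 0 (Set.Ioi 0)) (nhds z) := by
    have : Continuous fun t : ℝ => z - t • (Complex.I * (starRingEnd ℂ) u) := by fun_prop
    simpa using (this.tendsto 0).mono_left nhdsWithin_le_nhds
  obtain ⟨t, ht, ht0⟩ := ((hcont.eventually ((isOpen_triangleRegion v S).mem_nhds hz)).and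
    self_mem_nhdsWithin).exists
  have h1 : (u * p).im ≤ (u * (z - t • (Complex.I * (starRingEnd ℂ) u))).im :=
    hmin (subset_closure ht)
  have h2 : (u * (z - t • (Complex.I * (starRingEnd ℂ) u))).im =
      (u * z).im - t * Complex.normSq u := by
    simp [Complex.mul_im, Complex.mul_re, Complex.normSq_apply]
    ring
  have h3 : 0 < t * Complex.normSq u := mul_pos ht0 (Complex.normSq_pos.2 hu0)
  linarith

open scoped Classical in
/-- The number of bounded regions of a family of triangles is at most the number of intersection
points, pair by pair, plus the number of triangles. -/
theorem two_mul_card_regions_le (hn : 0 < n) (hv : ∀ i, IsTriangle (v i))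
    (hfin : ∀ i j, i ≠ j → (frontier (convexHull ℝ (Set.range (v i))) ∩
      frontier (convexHull ℝ (Set.range (v j)))).Finite)
    (hne : ∀ S : Set (Fin n), (triangleRegion v S).Nonempty) :
    2 * (2 ^ n - 1) ≤ ∑ i, ∑ j ∈ Finset.univ.erase i,
      (frontier (convexHull ℝ (Set.range (v i))) ∩
        frontier (convexHull ℝ (Set.range (v j)))).ncard + 2 * n := by
  obtain ⟨u, hu⟩ := exists_noHorizontalSide hv
  have hu0 := hu.ne_zero ⟨0, hn⟩
  set C : Fin n → Set ℂ := fun i => frontier (convexHull ℝ (Set.range (v i))) with hC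
  set F : Finset (Finset (Fin n)) := Finset.univ.erase ∅ with hF
  have hFcard : F.card = 2 ^ n - 1 := by
    rw [hF, Finset.card_erase_of_mem (Finset.mem_univ _), Finset.card_univ, Fintype.card_finset,
      Fintype.card_fin]
  have hlow (S : Finset (Fin n)) (hS : S ∈ F) := exists_lowest_point (v := v) hu0
    (S := (S : Set (Fin n))) (Finset.coe_nonempty.2
      (Finset.nonempty_iff_ne_empty.2 (Finset.ne_of_mem_erase hS))) (hne _)
  choose! P hPcl hPmin using hlow
  set M : ℂ → Finset (Fin n) := fun p => Finset.univ.filter fun i => p ∈ C i with hM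
  set B : ℂ → Finset (Fin n) := fun p => Finset.univ.filter fun i => IsBottom u (v i) p with hB
  have hlocal (p : ℂ) : 2 * (F.filter fun S => P S = p).card ≤
      (M p).offDiag.card + 2 * (B p).card := by
    have h1 := card_le_card_allUpSlopes hv hu hu0 p (F.filter fun S => P S = p)
      (fun S hS => by
        obtain ⟨hSF, rfl⟩ := Finset.mem_filter.1 hS
        exact hPcl S hSF)
      (fun S hS => by
        obtain ⟨hSF, rfl⟩ := Finset.mem_filter.1 hS
        exact hPmin S hSF)
    have h2 : (allUpSlopes u v p).card ≤ (M p).card + (B p).card := by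
      refine Finset.card_biUnion_le.trans ((Finset.sum_le_sum fun i _ =>
        card_upSlopes_le (hv i) p).trans (le_of_eq ?_))
      rw [Finset.sum_add_distrib, hM, hB]
      simp only [Finset.card_filter, hC]
    -- For m curves through `p`, m - 1 is at most the number of their pairs; truncated subtraction
    -- covers m = 0.
    have h3 : 2 * ((M p).card - 1) ≤ (M p).offDiag.card := by
      rw [Finset.offDiag_card]
      rcases Nat.lt_or_ge (M p).card 2 with h | h
      · interval_cases (M p).card <;> simp
      · obtain ⟨k, hk⟩ := Nat.exists_eq_add_of_le h
        rw [hk]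
        zify [show 1 ≤ 2 + k by omega, show 2 + k ≤ (2 + k) * (2 + k) by nlinarith]
        nlinarith
    omega
  have hsum : F.card = ∑ p ∈ F.image P, (F.filter fun S => P S = p).card :=
    Finset.card_eq_sum_card_image P F
  -- Interchanging the sums counts the incidences of ordered pairs by pair instead of by point.
  have hoff : ∑ p ∈ F.image P, (M p).offDiag.card ≤
      ∑ i, ∑ j ∈ Finset.univ.erase i, (C i ∩ C j).ncard := by
    have h1 (p : ℂ) : (M p).offDiag.card =
        ∑ i, ∑ j ∈ Finset.univ.erase i, if p ∈ C i ∩ C j then 1 else 0 := by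
      have : (M p).offDiag = ((Finset.univ.sigma fun i => Finset.univ.erase i).filter
        fun x : (_ : Fin n) × Fin n => p ∈ C x.1 ∩ C x.2).image fun x => (x.1, x.2) := by
        ext ⟨i, j⟩
        simp [hM, Finset.mem_offDiag, and_comm, and_assoc, eq_comm]
        tauto
      rw [this, Finset.card_image_of_injective _ (by rintro ⟨a, b⟩ ⟨c, d⟩ h; simpa using h),
        Finset.card_filter, Finset.sum_sigma]
    simp only [h1]
    rw [Finset.sum_comm]
    refine Finset.sum_le_sum fun i _ => ?_
    rw [Finset.sum_comm]
    refine Finset.sum_le_sum fun j hj => ?_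
    rw [← Finset.card_filter, ← Set.ncard_coe_finset]
    refine Set.ncard_le_ncard (fun p hp => ?_) (hfin i j (Finset.ne_of_mem_erase hj).symm)
    exact (Finset.mem_filter.1 hp).2
  have hbot : ∑ p ∈ F.image P, (B p).card ≤ n := by
    simp only [hB, Finset.card_filter]
    rw [Finset.sum_comm]
    refine (Finset.sum_le_sum (g := fun _ => 1) fun i _ => ?_).trans (by simp)
    rw [← Finset.card_filter]
    refine Finset.card_le_one.2 fun p hp q hq => ?_
    obtain ⟨a, rfl, ha⟩ := (Finset.mem_filter.1 hp).2
    obtain ⟨b, rfl, hb⟩ := (Finset.mem_filter.1 hq).2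
    by_contra hab
    have hab' : a ≠ b := fun h => hab (by rw [h])
    exact (ha b hab'.symm).not_gt (hb a hab')
  calc 2 * (2 ^ n - 1) = ∑ p ∈ F.image P, 2 * (F.filter fun S => P S = p).card := by
        rw [← hFcard, hsum, Finset.mul_sum]
    _ ≤ ∑ p ∈ F.image P, ((M p).offDiag.card + 2 * (B p).card) :=
        Finset.sum_le_sum fun p _ => hlocal p
    _ = ∑ p ∈ F.image P, (M p).offDiag.card + 2 * ∑ p ∈ F.image P, (B p).card := by
        rw [Finset.sum_add_distrib, Finset.mul_sum]
    _ ≤ ∑ i, ∑ j ∈ Finset.univ.erase i, (C i ∩ C j).ncard + 2 * n := by omega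

end Counting

/-! ### No Venn diagram of seven triangles. -/

section NoTriangles

lemma IsKGon.three_le {k : ℕ} {C : Set ℂ} (h : IsKGon k C) : 3 ≤ k := by
  obtain ⟨p, hp, -⟩ := h
  exact hp.three_le

lemma IsKGon.exists_isTriangle {C : Set ℂ} (h : IsKGon 3 C) :
    ∃ v, IsTriangle v ∧ C = frontier (convexHull ℝ (Set.range v)) := by
  obtain ⟨p, hp, rfl⟩ := h
  refine ⟨p.vertices, ⟨hp.convexIndependent.injective, ?_⟩, hp.boundary_eq⟩
  rw [← hp.boundary_eq]
  refine Set.iUnion_congr fun e => ?_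
  rw [Polygon.edgeSet, affineSegment_eq_segment]
  congr 2
  fin_cases e <;> rfl

lemma region_frontier_eq {n : ℕ} (v : Fin n → Fin 3 → ℂ) (S : Set (Fin n)) :
    region (fun i => frontier (convexHull ℝ (Set.range (v i)))) S = triangleRegion v S := by
  ext z
  simp only [region, curveInterior_frontier (convex_convexHull ℝ _) (isCompact_triangle _),
    curveExterior_frontier (convex_convexHull ℝ _) (isCompact_triangle _), triangleRegion,
    Set.mem_inter_iff, Set.mem_iInter, Set.mem_compl_iff, Set.mem_ofPred_eq]

variable {n : ℕ} {v : Fin n → Fin 3 → ℂ}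

/-- The corner is a limit of interior points of its own triangle, and the other triangles, being
closed, stay away from it. -/
lemma mem_closure_triangleRegion_singleton {i : Fin n}
    (hne : (interior (convexHull ℝ (Set.range (v i)))).Nonempty) {e : Fin 3}
    (he : ∀ j, j ≠ i → v i e ∉ convexHull ℝ (Set.range (v j))) :
    v i e ∈ closure (triangleRegion v {i}) := by
  have h1 : v i e ∈ closure (interior (convexHull ℝ (Set.range (v i)))) := by
    rw [(convex_convexHull ℝ _).closure_interior_eq_closure_of_nonempty_interior hne]
    exact subset_closure (subset_convexHull ℝ _ ⟨e, rfl⟩)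
  have hU : IsOpen (⋂ j ∈ ({i}ᶜ : Set (Fin n)), (convexHull ℝ (Set.range (v j)))ᶜ) :=
    (Set.toFinite _).isOpen_biInter fun j _ => (isClosed_triangle (v j)).isOpen_compl
  have hmem : v i e ∈ ⋂ j ∈ ({i}ᶜ : Set (Fin n)), (convexHull ℝ (Set.range (v j)))ᶜ :=
    Set.mem_iInter₂.2 fun j hj => he j hj
  have h2 := hU.inter_closure ⟨hmem, h1⟩
  refine closure_mono ?_ h2
  rintro z ⟨hz, hz'⟩
  refine ⟨?_, fun j hj => Set.mem_iInter₂.1 hz j hj⟩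
  rintro j rfl
  exact hz'

/-- In a Venn diagram of triangles, each triangle meets the others in fewer points than
possible. -/
lemma sum_ncard_inter_le (hv : ∀ i, IsTriangle (v i))
    (hfin : ∀ i j, i ≠ j → (frontier (convexHull ℝ (Set.range (v i))) ∩
      frontier (convexHull ℝ (Set.range (v j)))).Finite)
    (hreg : ∀ S : Set (Fin n), IsConnected (triangleRegion v S)) (hn : 2 ≤ n) (i : Fin n) :
    ∑ j ∈ Finset.univ.erase i, (frontier (convexHull ℝ (Set.range (v i))) ∩
      frontier (convexHull ℝ (Set.range (v j)))).ncard + 2 ≤ 6 * (n - 1) := by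
  classical
  have hcard : (Finset.univ.erase i).card = n - 1 := by
    rw [Finset.card_erase_of_mem (Finset.mem_univ i), Finset.card_univ, Fintype.card_fin]
  -- With two corners free of the other triangles, each intersection number drops to four. Otherwise
  -- at least two corners are covered, and each covering costs a point.
  by_cases hfree : ∃ e : Fin 3, (∀ j, j ≠ i → v i e ∉ convexHull ℝ (Set.range (v j))) ∧
      ∀ j, j ≠ i → v i (e + 1) ∉ convexHull ℝ (Set.range (v j))
  · obtain ⟨e, h1, h2⟩ := hfree
    have hsub : triangleRegion v {i} ⊆ interior (convexHull ℝ (Set.range (v i))) :=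
      fun z hz => hz.1 i rfl
    have hne := (hreg {i}).nonempty.mono hsub
    have h4 : ∀ j ∈ Finset.univ.erase i, (frontier (convexHull ℝ (Set.range (v i))) ∩
        frontier (convexHull ℝ (Set.range (v j)))).ncard ≤ 4 := by
      intro j hj
      have hji := Finset.ne_of_mem_erase hj
      refine (hv i).ncard_inter_le_four (hfin i j hji.symm) (e := e) ?_
      refine disjoint_sides_of_isPreconnected (hv i) hne (convex_convexHull ℝ _)
        (hreg {i}).isPreconnected hsub ?_ (mem_closure_triangleRegion_singleton hne h1)
        (mem_closure_triangleRegion_singleton hne h2) (h1 j hji) (h2 j hji)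
      exact Set.disjoint_left.2 fun z hz => hz.2 j hji
    have := Finset.sum_le_card_nsmul _ _ 4 h4
    rw [hcard, smul_eq_mul] at this
    omega
  · have h6 : ∑ j ∈ Finset.univ.erase i, ((frontier (convexHull ℝ (Set.range (v i))) ∩
        frontier (convexHull ℝ (Set.range (v j)))).ncard +
        ∑ e, if v i e ∈ convexHull ℝ (Set.range (v j)) then 1 else 0) ≤ (n - 1) * 6 := by
      rw [← hcard]
      exact Finset.sum_le_card_nsmul _ _ 6 fun j hj =>
        (hv i).ncard_inter_add_le (hfin i j (Finset.ne_of_mem_erase hj).symm)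
    rw [Finset.sum_add_distrib, Finset.sum_comm, Fin.sum_univ_three] at h6
    have hpos (e : Fin 3) (h : ¬ ∀ j, j ≠ i → v i e ∉ convexHull ℝ (Set.range (v j))) :
        1 ≤ ∑ j ∈ Finset.univ.erase i,
          if v i e ∈ convexHull ℝ (Set.range (v j)) then 1 else 0 := by
      push Not at h
      obtain ⟨j, hj, hmem⟩ := h
      rw [← Finset.card_filter, Nat.succ_le_iff, Finset.card_pos]
      exact ⟨j, Finset.mem_filter.2 ⟨Finset.mem_erase.2 ⟨hj, Finset.mem_univ _⟩, hmem⟩⟩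
    have hpair (e : Fin 3) : 1 ≤ (∑ j ∈ Finset.univ.erase i,
          if v i e ∈ convexHull ℝ (Set.range (v j)) then 1 else 0) +
        ∑ j ∈ Finset.univ.erase i,
          if v i (e + 1) ∈ convexHull ℝ (Set.range (v j)) then 1 else 0 := by
      by_cases h : ∀ j, j ≠ i → v i e ∉ convexHull ℝ (Set.range (v j))
      · have := hpos (e + 1) fun h' => hfree ⟨e, h, h'⟩
        omega
      · have := hpos e h
        omega
    -- The three inequalities add up to 3 for twice the total, so the total is at least 2 by
    -- integrality.
    have h7 := hpair 0
    have h8 := hpair 1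
    have h9 := hpair 2
    simp only [zero_add, show (1 : Fin 3) + 1 = 2 from rfl, show (2 : Fin 3) + 1 = 0 from rfl]
      at h7 h8 h9
    omega

/-- There is no Venn diagram of seven triangles, simple or not. -/
theorem not_isVennDiagram_triangles {C : Fin 7 → Set ℂ} (hC : IsVennDiagram C)
    (h : ∀ i, IsKGon 3 (C i)) : False := by
  choose v hv hCv using fun i => (h i).exists_isTriangle
  obtain rfl : C = fun i => frontier (convexHull ℝ (Set.range (v i))) := funext hCv
  have hreg (S : Set (Fin 7)) : IsConnected (triangleRegion v S) :=
    region_frontier_eq v S ▸ hC.region_connected S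
  have h1 := two_mul_card_regions_le (by norm_num) hv hC.finite_inter fun S => (hreg S).nonempty
  have h2 : ∀ i ∈ (Finset.univ : Finset (Fin 7)), ∑ j ∈ Finset.univ.erase i,
      (frontier (convexHull ℝ (Set.range (v i))) ∩
        frontier (convexHull ℝ (Set.range (v j)))).ncard ≤ 34 := by
    intro i _
    have := sum_ncard_inter_le hv hC.finite_inter hreg (by norm_num) i
    omega
  -- The sum is at most 7 * 34 = 238, while `h1` demands at least 2 * 127 - 14 = 240.
  have h3 := Finset.sum_le_card_nsmul _ _ 34 h2
  rw [Finset.card_univ, Fintype.card_fin, smul_eq_mul] at h3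
  omega

lemma four_le_of_isVennDiagram {k : ℕ} {C : Fin 7 → Set ℂ} (hC : IsVennDiagram C)
    (h : ∀ i, IsKGon k (C i)) : 4 ≤ k := by
  have h3 := (h 0).three_le
  by_contra! hk
  obtain rfl : k = 3 := by omega
  exact not_isVennDiagram_triangles hC h

lemma lowerBound_seven : lowerBound 7 = 4 := by
  rw [lowerBound, Nat.ceil_eq_iff (by norm_num)]
  norm_num

lemma kStar_seven : kStar 7 = 4 := by
  refine IsLeast.csInf_eq ⟨⟨sevenQuads, isVennDiagram_sevenQuads, isKGon_sevenQuads⟩, ?_⟩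
  rintro k ⟨C, hC, h⟩
  exact four_le_of_isVennDiagram hC h

end NoTriangles

end KGonVenn

theorem mainTheorem4 :
    KGonVenn.IsVennDiagram KGonVenn.sevenQuads ∧
    KGonVenn.IsSimpleFamily KGonVenn.sevenQuads ∧
    KGonVenn.IsRotationallySymmetric 0 KGonVenn.sevenQuads ∧
    (∀ i, KGonVenn.IsKGon 4 (KGonVenn.sevenQuads i)) ∧
    (∀ i j, KGonVenn.IsCongruent (KGonVenn.sevenQuads i) (KGonVenn.sevenQuads j)) ∧
    KGonVenn.lowerBound 7 = 4 ∧
    IsLeast (KGonVenn.simpleSizes 7) (KGonVenn.lowerBound 7) ∧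
    KGonVenn.kStar 7 = 4 := by
  refine ⟨KGonVenn.isVennDiagram_sevenQuads, KGonVenn.isSimpleFamily_sevenQuads,
    KGonVenn.isRotationallySymmetric_sevenQuads, KGonVenn.isKGon_sevenQuads,
    KGonVenn.isCongruent_sevenQuads, KGonVenn.lowerBound_seven, ?_, KGonVenn.kStar_seven⟩
  rw [KGonVenn.lowerBound_seven]
  refine ⟨⟨KGonVenn.sevenQuads, KGonVenn.isVennDiagram_sevenQuads,
    KGonVenn.isSimpleFamily_sevenQuads, KGonVenn.isKGon_sevenQuads⟩, ?_⟩
  rintro k ⟨C, hC, -, h⟩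
  exact KGonVenn.four_le_of_isVennDiagram hC h
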